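/- For $\tau\in\mathbb H$ let $\wp(z|\tau)$ and $\zeta(z|\tau)$ be the Weierstrass functions of the lattice $\mathbb Z+\mathbb Z\tau$, $\eta_1(\tau)=\zeta(z+1|\tau)-\zeta(z|\tau)$, $\eta_2(\tau)=\zeta(z+\tau|\tau)-\zeta(z|\tau)$, $e_1=\wp(\tfrac12|\tau)$, $e_2=\wp(\tfrac{\tau}{2}|\tau)$, $e_3=\wp(\tfrac{1+\tau}{2}|\tau)$, and $$t=t(\tau)=\frac{e_3(\tau)-e_1(\tau)}{e_2(\tau)-e_1(\tau)}.$$ Let $(r,s)\in\mathbb C^2\setminus\frac12\mathbb Z^2$, $Z_{r,s}(\tau)=\zeta(r+s\tau|\tau)-r\eta_1(\tau)-s\eta_2(\tau)$, and let $$\lambda^{(0)}_{r,s}(t)=\frac{1}{e_2-e_1}\left(\wp(r+s\tau|\tau)+\frac{\wp'(r+s\tau|\tau)}{2Z_{r,s}(\tau)}-e_1\right)$$ be Hitchin's solution of the Painlevé VI equation with parameters $(\alpha,\beta,\gamma,\delta)=(\frac18,-\frac18,\frac18,\frac38)$, regarded as a function of $\tau$ through $t=t(\tau)$. With $\theta^0=(\theta_0,\dots,\theta_4)=(-\frac12,\frac12,\frac12,\frac12,\frac12)$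 let $\mu^{(0)}_{r,s}$ be the momentum that belongs to $\lambda=\lambda^{(0)}_{r,s}$ in the Hamiltonian form of Painlevé VI, i.e. $$t(t-1)\frac{d\lambda}{dt}=2\lambda(\lambda-1)(\lambda-t)\mu-\theta_1(\lambda-1)(\lambda-t)-\theta_2\lambda(\lambda-t)-(\theta_3-1)\lambda(\lambda-1).$$ The Okamoto transformations act on $(\theta,\lambda,\mu)$, with $t$ fixed, as follows: $\kappa_0$ maps $\theta_0\mapsto-\theta_0$, $\theta_i\mapsto\theta_i+\theta_0$ $(1\le i\le 4)$, $\lambda\mapsto\lambda+\theta_0/\mu$, $\mu\mapsto\mu$; for $1\le i\le4$, $\kappa_i$ maps $\theta_0\mapsto\theta_0+\theta_i$, $\theta_i\mapsto-\theta_i$, keeps the other $\theta_j$ and $\lambda$, and maps $\mu$ to $\mu-\frac{\theta_1}{\lambda}$, $\mu-\frac{\theta_2}{\lambda-1}$, $\mu-\frac{\theta_3}{\lambda-t}$, $\mu$ for $i=1,2,3,4$ respectively. Put $\kappa_5=\kappa_0(\kappa_3\kappa_2\kappa_1\kappa_0)^2\kappa_4$ (the rightmost map acts first). For $n\ge0$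 let $\lambda^{(n)}_{r,s}$ be the $\lambda$-component of the image of $(\theta^0,\lambda^{(0)}_{r,s},\mu^{(0)}_{r,s})$ under $\kappa_5^m$ if $n=2m$, and under $\kappa_5^m\kappa_0\kappa_3\kappa_2\kappa_1$ if $n=2m+1$; it is a solution of the Painlevé VI equation with parameters $(\frac12(n+\frac12)^2,-\frac18,\frac18,\frac38)$. Let $$F_2=\{\tau\in\mathbb H:\ 0\le\operatorname{Re}\tau<2,\ |\tau-\tfrac12|\ge\tfrac12,\ |\tau-\tfrac32|>\tfrac12\}.$$ **Theorem.** Fix an integer $n\ge 0$ and $(r,s)\in\mathbb C^2\setminus\frac12\mathbb Z^2$ with $\operatorname{Re}s\in(0,\frac12)$. Then, as $F_2\ni\tau\to\infty$, $t=t(\tau)\to1$ and $$\lambda^{(n)}_{r,s}(t)=1+C^{(n)}(s)\,e^{2\pi i r}\left(\frac{1-t}{16}\right)^{2s}+o\left(|1-t|^{2\operatorname{Re}s}\right),$$ where the power is taken with the branch $0\le\arg(1-t)<2\pi$ (the branch that is continuous for $\tau\in F_2$ and has $\arg(1-t)=0$ for $\operatorname{Re}\tau=0$), and $$C^{(n)}(s)=\begin{cases}\dfrac{8s}{2s-1}\displaystyle\prod_{k=0}^{m-1}\frac{(s+k)(s+k+\frac12)}{(s-k-1)(s-k-\frac32)}&\text{if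 }n=2m,\\[3mm]\dfrac{8s^2}{(2s-1)(s-1)}\displaystyle\prod_{k=0}^{m-1}\frac{(s+k+\frac12)(s+k+1)}{(s-k-\frac32)(s-k-2)}&\text{if }n=2m+1,\end{cases}$$ with empty products equal to $1$. -/

import Mathlib

open UpperHalfPlane

noncomputable section

namespace PainleveLame

/-- The pair of periods `(1, τ)`, with lattice `Λ_τ = ℤ + ℤ τ`. -/
def periods (τ : ℍ) : PeriodPair where
  ω₁ := 1
  ω₂ := τ
  indep := by
    refine (LinearIndependent.pair_iff).2 fun a b h => ?_
    have hi := congrArg Complex.im h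
    have hr := congrArg Complex.re h
    simp only [Complex.add_im, Complex.add_re, Complex.real_smul, Complex.mul_im, Complex.mul_re,
      Complex.ofReal_re, Complex.ofReal_im, Complex.zero_re, Complex.zero_im, mul_one, zero_mul,
      add_zero, zero_add, sub_zero] at hi hr
    have hb : b = 0 := (mul_eq_zero.1 hi).resolve_right τ.im_pos.ne'
    subst hb
    simpa using hr

/-- The Weierstrass function `℘(z | τ)`. -/
def wp (τ : ℍ) (z : ℂ) : ℂ := (periods τ).weierstrassP z

/-- The derivative `℘'(z | τ)` with respect to `z`. -/
def wpDeriv (τ : ℍ) (z : ℂ) : ℂ := (periods τ).derivWeierstrassP z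

/-- The Weierstrass zeta function
`ζ(z | τ) = 1/z + ∑_{ω ∈ Λ_τ, ω ≠ 0} (1/(z - ω) + 1/ω + z/ω²)`.
Because of `1 / 0 = 0`, the summand of `ω = 0` is `1/z`. -/
def wZeta (τ : ℍ) (z : ℂ) : ℂ :=
  ∑' l : (periods τ).lattice, (1 / (z - l) + 1 / (l : ℂ) + z / (l : ℂ) ^ 2)

/-- The quasi-period `η₁(τ) = ζ(z + 1 | τ) - ζ(z | τ)`; it does not depend on `z`, and we take
`z = -1/2`. -/
def eta₁ (τ : ℍ) : ℂ := wZeta τ (1 / 2) - wZeta τ (-(1 / 2))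

/-- The quasi-period `η₂(τ) = ζ(z + τ | τ) - ζ(z | τ)`; it does not depend on `z`, and we take
`z = -τ/2`. -/
def eta₂ (τ : ℍ) : ℂ := wZeta τ ((τ : ℂ) / 2) - wZeta τ (-((τ : ℂ) / 2))

/-- `e₁(τ) = ℘(1/2 | τ)`. -/
def e₁ (τ : ℍ) : ℂ := wp τ (1 / 2)

/-- `e₂(τ) = ℘(τ/2 | τ)`. -/
def e₂ (τ : ℍ) : ℂ := wp τ ((τ : ℂ) / 2)

/-- `e₃(τ) = ℘((1 + τ)/2 | τ)`. -/
def e₃ (τ : ℍ) : ℂ := wp τ ((1 + (τ : ℂ)) / 2)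

/-- The covering map `t(τ) = (e₃ - e₁) / (e₂ - e₁)` from `ℍ` onto `ℂ \ {0, 1}`. -/
def tt (τ : ℍ) : ℂ := (e₃ τ - e₁ τ) / (e₂ τ - e₁ τ)

/-- `Z_{r,s}(τ) = ζ(r + sτ | τ) - r η₁(τ) - s η₂(τ)`. -/
def Z (r s : ℂ) (τ : ℍ) : ℂ := wZeta τ (r + s * τ) - r * eta₁ τ - s * eta₂ τ

/-- Hitchin's solution of `PVI(1/8, -1/8, 1/8, 3/8)`, as a function of `τ` through `t = t(τ)`:
`λ⁽⁰⁾ = (℘(p) - e₁) / (e₂ - e₁)` with `℘(p) = ℘(r + sτ) + ℘'(r + sτ) / (2 Z_{r,s}(τ))`. -/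
def lam₀ (r s : ℂ) (τ : ℍ) : ℂ :=
  (wp τ (r + s * τ) + wpDeriv τ (r + s * τ) / (2 * Z r s τ) - e₁ τ) / (e₂ τ - e₁ τ)

/-- The derivative with respect to `t` of a function on `ℍ`, viewed as a (multivalued) function of
`t = t(τ)`: `df/dt = (df/dτ) / (dt/dτ)`. -/
def ddt (f : ℍ → ℂ) (τ : ℍ) : ℂ :=
  deriv (f ∘ ofComplex) (τ : ℂ) / deriv (tt ∘ ofComplex) (τ : ℂ)

/-- A point of the phase space of the Hamiltonian form of Painlevé VI: parameters `θ₀, …, θ₄`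
(subject to `2θ₀ + θ₁ + θ₂ + θ₃ + θ₄ = 1` in all uses below), the time `t`, and `(λ, μ)`. -/
structure Pt where
  θ₀ : ℂ
  θ₁ : ℂ
  θ₂ : ℂ
  θ₃ : ℂ
  θ₄ : ℂ
  t : ℂ
  lam : ℂ
  mu : ℂ

/-- The momentum `μ` that belongs to `λ` by the first Hamiltonian equation `dλ/dt = ∂K/∂μ`, that is
`t (t-1) λ' = 2 λ (λ-1) (λ-t) μ - θ₁ (λ-1) (λ-t) - θ₂ λ (λ-t) - (θ₃-1) λ (λ-1)`. -/
def momentum (θ₁ θ₂ θ₃ t lam lam' : ℂ) : ℂ :=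
  (t * (t - 1) * lam' + θ₁ * (lam - 1) * (lam - t) + θ₂ * lam * (lam - t)
    + (θ₃ - 1) * lam * (lam - 1)) / (2 * lam * (lam - 1) * (lam - t))

/-- The Okamoto transformation `κ₀`. -/
def κ₀ (P : Pt) : Pt where
  θ₀ := -P.θ₀
  θ₁ := P.θ₁ + P.θ₀
  θ₂ := P.θ₂ + P.θ₀
  θ₃ := P.θ₃ + P.θ₀
  θ₄ := P.θ₄ + P.θ₀
  t := P.t
  lam := P.lam + P.θ₀ / P.mu
  mu := P.mu

/-- The Okamoto transformation `κ₁`. -/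
def κ₁ (P : Pt) : Pt :=
  { P with θ₀ := P.θ₀ + P.θ₁, θ₁ := -P.θ₁, mu := P.mu - P.θ₁ / P.lam }

/-- The Okamoto transformation `κ₂`. -/
def κ₂ (P : Pt) : Pt :=
  { P with θ₀ := P.θ₀ + P.θ₂, θ₂ := -P.θ₂, mu := P.mu - P.θ₂ / (P.lam - 1) }

/-- The Okamoto transformation `κ₃`. -/
def κ₃ (P : Pt) : Pt :=
  { P with θ₀ := P.θ₀ + P.θ₃, θ₃ := -P.θ₃, mu := P.mu - P.θ₃ / (P.lam - P.t) }

/-- The Okamoto transformation `κ₄`. -/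
def κ₄ (P : Pt) : Pt :=
  { P with θ₀ := P.θ₀ + P.θ₄, θ₄ := -P.θ₄ }

/-- `κ₅ = κ₀ (κ₃ κ₂ κ₁ κ₀)² κ₄`, which maps `θ` to `(θ₀ - 1, θ₁, θ₂, θ₃, θ₄ + 2)`. -/
def κ₅ : Pt → Pt := κ₀ ∘ (κ₃ ∘ κ₂ ∘ κ₁ ∘ κ₀)^[2] ∘ κ₄

/-- The transformation `κ^{0,n}` from the parameters `θ⁰` to
`θⁿ = (-(n+1)/2, 1/2, 1/2, 1/2, n + 1/2)`: it is `κ₅^m` for `n = 2m`, and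
`κ₅^m ∘ (κ₀ κ₃ κ₂ κ₁)` for `n = 2m + 1`. -/
def κ₀ₙ (n : ℕ) : Pt → Pt :=
  if Even n then κ₅^[n / 2] else κ₅^[n / 2] ∘ (κ₀ ∘ κ₃ ∘ κ₂ ∘ κ₁)

/-- The point of phase space, with parameters `θ⁰ = (-1/2, 1/2, 1/2, 1/2, 1/2)`, of Hitchin's
solution at `t = t(τ)`. -/
def hitchinPt (r s : ℂ) (τ : ℍ) : Pt where
  θ₀ := -(1 / 2)
  θ₁ := 1 / 2
  θ₂ := 1 / 2
  θ₃ := 1 / 2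
  θ₄ := 1 / 2
  t := tt τ
  lam := lam₀ r s τ
  mu := momentum (1 / 2) (1 / 2) (1 / 2) (tt τ) (lam₀ r s τ) (ddt (lam₀ r s) τ)

/-- The solution `λ⁽ⁿ⁾_{r,s}` of `PVI((n + 1/2)²/2, -1/8, 1/8, 3/8)`, as a function of `τ` through
`t = t(τ)`: the image of Hitchin's solution under `κ^{0,n}`. The formulas are evaluated pointwise;
where an intermediate denominator vanishes the value is a convention. -/
def lam (n : ℕ) (r s : ℂ) (τ : ℍ) : ℂ := (κ₀ₙ n (hitchinPt r s τ)).lam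

/-- The fundamental domain of `Γ(2)`. -/
def F₂ : Set ℍ :=
  {τ | 0 ≤ τ.re ∧ τ.re < 2 ∧ 1 / 2 ≤ ‖(τ : ℂ) - 1 / 2‖ ∧ 1 / 2 < ‖(τ : ℂ) - 3 / 2‖}

/-- The filter of `F₂ ∋ τ → ∞`. -/
def F₂atInfty : Filter ℍ :=
  Filter.comap (fun τ : ℍ => ‖(τ : ℂ)‖) Filter.atTop ⊓ Filter.principal F₂

/-- The power `z ^ w` with the branch of the argument `0 ≤ arg z < 2π`. For `τ` in `F₂` this is the
branch of a power of `1 - t(τ)` that is continuous in `τ` and has `arg = 0` for `re τ = 0`. -/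
def cpow₂ (z w : ℂ) : ℂ :=
  Complex.exp (w * (Real.log ‖z‖ + (toIcoMod Real.two_pi_pos 0 (Complex.arg z) : ℝ) * Complex.I))

/-- The constant `C⁽ⁿ⁾(s)`. -/
def C (n : ℕ) (s : ℂ) : ℂ :=
  if Even n then
    8 * s / (2 * s - 1) *
      ∏ k ∈ Finset.range (n / 2), ((s + k) * (s + k + 1 / 2)) / ((s - k - 1) * (s - k - 3 / 2))
  else
    8 * s ^ 2 / ((2 * s - 1) * (s - 1)) *
      ∏ k ∈ Finset.range (n / 2),
        ((s + k + 1 / 2) * (s + k + 1)) / ((s - k - 3 / 2) * (s - k - 2))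

end PainleveLame

end

noncomputable section

namespace PainleveLame

open Filter Topology Metric

/-! Everything is read off from the `q`-expansions as `τ → i∞` in a strip. Put `u = e^{2πi(r+sτ)}`
and `q = e^{2πiτ}`. Since `0 < Re s < 1/2`, `u → 0` while both `q^{1/2}` and `q/u` are `o(u)`.
Summing the lattice row by row expresses `℘`, `℘'`, `ζ`, `η₁`, `η₂` through Lambert series, whence
`1 - t ~ 16 q^{1/2}`, `℘(r+sτ) - e₂ ~ (2πi)² u`, `℘'(r+sτ) ~ (2πi)³ u`, `Z → 2πi (s - 1/2)` and `e₂
- e₁ → (2πi)²/4`. Hence `λ⁽⁰⁾ - 1 ~ a u` with `a = 8s/(2s-1)` (`tendsto_lam₀_sub_one_div`).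

Cauchy's estimate allows these asymptotics to be differentiated, so `(t-1) dλ/dt ~ 2s a u`, and the
formula for the momentum gives `μ ~ s/(a u)` (`tendsto_momentum`).

The Okamoto transformations act on leading terms `λ - 1 ~ a u`, `μ ~ c/(a u)`, recorded in
`IsAsymp`: `κ₁` and `κ₄` keep `(a, c)`, `κ₂` and `κ₃` lower `c` by `θ₂` and `θ₃`, and `κ₀` maps `(a,
c)` to `(a (c+θ₀)/c, c+θ₀)`. Along `κ₅` the exponent `c` returns to `s` and `a` picks up one factor
of the product `C n s` (`IsAsymp.okamoto_five`, `isAsymp_κ₀ₙ`). Every `c` met on the way is `s` plus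
a half-integer, hence nonzero.

Finally `u` is rewritten as `e^{2πir} ((1-t)/16)^{2s} (1 + o(1))` with the prescribed branch
(`eventually_cpow₂_eq`), and `u = O(|1-t|^{2 Re s})` turns the error `o(u)` into the stated one. -/

/-! ### The limit `τ → i∞` in vertical strips. -/

/-- The filter of `τ → i∞` in vertical strips of bounded width. -/
def vertInfty : Filter ℂ :=
  ⨆ A : ℝ, comap Complex.im atTop ⊓ 𝓟 {τ | |τ.re| ≤ A}

theorem eventually_vertInfty {p : ℂ → Prop} :
    (∀ᶠ τ in vertInfty, p τ) ↔ ∀ A : ℝ, ∃ M : ℝ, ∀ τ : ℂ, |τ.re| ≤ A → M ≤ τ.im → p τ := by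
  simp only [vertInfty, eventually_iSup, eventually_inf_principal, eventually_comap,
    eventually_atTop]
  refine forall_congr' fun A => exists_congr fun M => ⟨fun h τ h1 h2 => h _ h2 τ rfl h1, ?_⟩
  rintro h b hb τ rfl h1
  exact h τ h1 hb

/-- Allowing every strip width makes the filter stable under unit discs, which a single fixed strip
such as `F₂` is not; Cauchy estimates need this room. -/
theorem eventually_vertInfty_closedBall {p : ℂ → Prop} (h : ∀ᶠ τ in vertInfty, p τ) :
    ∀ᶠ τ in vertInfty, ∀ σ ∈ closedBall τ 1, p σ := by
  rw [eventually_vertInfty] at h ⊢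
  intro A
  obtain ⟨M, hM⟩ := h (A + 1)
  refine ⟨M + 1, fun τ h1 h2 σ hσ => ?_⟩
  rw [mem_closedBall, Complex.dist_eq] at hσ
  have hr := (Complex.abs_re_le_norm (σ - τ)).trans hσ
  have hi := (Complex.abs_im_le_norm (σ - τ)).trans hσ
  rw [Complex.sub_re, abs_le] at hr
  rw [Complex.sub_im, abs_le] at hi
  rw [abs_le] at h1
  exact hM σ (abs_le.2 ⟨by linarith, by linarith⟩) (by linarith)

theorem eventually_vertInfty_nhds {p : ℂ → Prop} (h : ∀ᶠ τ in vertInfty, p τ) :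
    ∀ᶠ τ in vertInfty, ∀ᶠ σ in 𝓝 τ, p σ := by
  filter_upwards [eventually_vertInfty_closedBall h] with τ hτ
  filter_upwards [closedBall_mem_nhds τ one_pos] with σ hσ using hτ σ hσ

theorem eventually_differentiableAt_congr {f g : ℂ → ℂ} (h : f =ᶠ[vertInfty] g)
    (hg : ∀ᶠ τ in vertInfty, DifferentiableAt ℂ g τ) :
    ∀ᶠ τ in vertInfty, DifferentiableAt ℂ f τ := by
  filter_upwards [eventually_vertInfty_nhds h, hg] with τ h1 h2
  exact h2.congr_of_eventuallyEq h1

/-- A Cauchy estimate: the derivative of a convergent holomorphic function tends to `0`. -/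
theorem tendsto_deriv_vertInfty {g : ℂ → ℂ} {c : ℂ} (hg : Tendsto g vertInfty (𝓝 c))
    (hd : ∀ᶠ τ in vertInfty, DifferentiableAt ℂ g τ) :
    Tendsto (deriv g) vertInfty (𝓝 0) := by
  rw [Metric.tendsto_nhds]
  intro ε hε
  have h1 := (Metric.tendsto_nhds.1 hg) (ε / 2) (half_pos hε)
  filter_upwards [eventually_vertInfty_closedBall h1, eventually_vertInfty_closedBall hd]
    with τ h2 h3
  rw [dist_zero_right]
  have h4 : ‖deriv (fun σ => g σ - c) τ‖ ≤ ε / 2 / 1 := by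
    refine Complex.norm_deriv_le_of_forall_mem_sphere_norm_le one_pos ?_ fun σ hσ => ?_
    · refine DifferentiableOn.diffContOnCl fun σ hσ => ?_
      rw [closure_ball _ one_ne_zero] at hσ
      exact ((h3 σ hσ).sub_const c).differentiableWithinAt
    · have := h2 σ (sphere_subset_closedBall hσ)
      rw [dist_eq_norm] at this
      exact this.le
  rw [deriv_sub_const] at h4
  linarith

/-- Exponentials `e^{a τ + b}` with `Im a > 0` decay. -/
theorem tendsto_cexp_vertInfty {a : ℂ} (b : ℂ) (ha : 0 < a.im) :
    Tendsto (fun τ : ℂ => Complex.exp (a * τ + b)) vertInfty (𝓝 0) := by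
  rw [Metric.tendsto_nhds]
  intro ε hε
  rw [eventually_vertInfty]
  intro A
  refine ⟨(|a.re| * A + b.re - Real.log ε + 1) / a.im, fun τ h1 h2 => ?_⟩
  rw [dist_zero_right, Complex.norm_exp, ← Real.lt_log_iff_exp_lt hε]
  rw [div_le_iff₀ ha] at h2
  have h3 : a.re * τ.re ≤ |a.re| * A :=
    (le_abs_self _).trans (by rw [abs_mul]; gcongr)
  simp only [Complex.add_re, Complex.mul_re]
  nlinarith

theorem eventually_im_gt_vertInfty (M : ℝ) : ∀ᶠ τ in vertInfty, M < τ.im := by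
  rw [eventually_vertInfty]
  exact fun A => ⟨M + 1, fun τ _ h => by linarith⟩

theorem eventually_mem_F₂ : ∀ᶠ τ : ℍ in F₂atInfty, τ ∈ F₂ :=
  Eventually.filter_mono inf_le_right (by simp)

/-- In `F₂` the real part is bounded, so `|τ| → ∞` forces `Im τ → ∞`. -/
theorem tendsto_coe_F₂atInfty : Tendsto (fun τ : ℍ => (τ : ℂ)) F₂atInfty vertInfty := by
  intro S hS
  obtain ⟨M, hM⟩ := (eventually_vertInfty.1 hS) 2
  have h1 : ∀ᶠ τ : ℍ in F₂atInfty, |M| + 2 ≤ ‖(τ : ℂ)‖ := by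
    refine Eventually.filter_mono inf_le_left ?_
    exact (tendsto_comap.eventually (eventually_ge_atTop (|M| + 2)))
  rw [mem_map]
  filter_upwards [h1, eventually_mem_F₂] with τ h3 h4
  obtain ⟨h5, h6, -⟩ := h4
  have h7 := Complex.norm_le_abs_re_add_abs_im (τ : ℂ)
  have h8 : |(τ : ℂ).re| ≤ 2 := abs_le.2 ⟨by simp; linarith, by simp; linarith⟩
  refine hM _ h8 ?_
  have h9 : |(τ : ℂ).im| = τ.im := abs_of_pos τ.im_pos
  have := le_abs_self M
  simp at h9 ⊢
  simp only [coe_im] at h7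
  linarith [abs_of_pos τ.im_pos]

/-! ### Lambert series: bounds, holomorphy, leading term. -/

/-- `∑_{n ≥ 1} x ^ n` in closed form. -/
def geom₀ (x : ℂ) : ℂ := x / (1 - x)

/-- `∑ n x ^ n` in closed form. -/
def geom₁ (x : ℂ) : ℂ := x / (1 - x) ^ 2

/-- `∑ n ^ 2 x ^ n` in closed form. -/
def geom₂ (x : ℂ) : ℂ := x * (1 + x) / (1 - x) ^ 3

/-- A function that is holomorphic in the unit disc and vanishes at `0`, with an explicit bound. -/
structure IsSmall (f : ℂ → ℂ) : Prop where
  diff : DifferentiableOn ℂ f (ball 0 1)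
  bound : ∀ x, ‖x‖ ≤ 1 / 2 → ‖f x‖ ≤ 12 * ‖x‖

theorem one_sub_ne_zero_of_norm_lt {x : ℂ} (hx : ‖x‖ < 1) : 1 - x ≠ 0 := by
  rintro h
  rw [← sub_eq_zero.1 h] at hx
  simp at hx

theorem half_le_norm_one_sub {x : ℂ} (hx : ‖x‖ ≤ 1 / 2) : 1 / 2 ≤ ‖1 - x‖ := by
  have := norm_sub_norm_le (1 : ℂ) x
  rw [norm_one] at this
  linarith

theorem isSmall_geom₀ : IsSmall geom₀ where
  diff x hx := by
    have h := one_sub_ne_zero_of_norm_lt (mem_ball_zero_iff.1 hx)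
    unfold geom₀
    fun_prop (disch := exact h)
  bound x hx := by
    have h := half_le_norm_one_sub hx
    rw [geom₀, norm_div, div_le_iff₀ (by linarith)]
    nlinarith [norm_nonneg x]

theorem isSmall_geom₁ : IsSmall geom₁ where
  diff x hx := by
    have h := one_sub_ne_zero_of_norm_lt (mem_ball_zero_iff.1 hx)
    unfold geom₁
    fun_prop (disch := exact pow_ne_zero _ h)
  bound x hx := by
    have h := pow_le_pow_left₀ (by norm_num) (half_le_norm_one_sub hx) 2
    rw [geom₁, norm_div, norm_pow, div_le_iff₀ (by linarith)]
    nlinarith [norm_nonneg x]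

/-- The worst of the three cases: `(3/2) / (1/2)³ = 12` is the constant in `IsSmall`. -/
theorem isSmall_geom₂ : IsSmall geom₂ where
  diff x hx := by
    have h := one_sub_ne_zero_of_norm_lt (mem_ball_zero_iff.1 hx)
    unfold geom₂
    fun_prop (disch := exact pow_ne_zero _ h)
  bound x hx := by
    have h := pow_le_pow_left₀ (by norm_num) (half_le_norm_one_sub hx) 3
    have h1 : ‖1 + x‖ ≤ 3 / 2 := (norm_add_le _ _).trans (by rw [norm_one]; linarith)
    rw [geom₂, norm_div, norm_pow, norm_mul, div_le_iff₀ (by linarith)]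
    nlinarith [norm_nonneg x, mul_le_mul_of_nonneg_left h1 (norm_nonneg x)]

/-- The Lambert type series `∑_{m ≥ 0} f (x q ^ m)`. -/
def lambert (f : ℂ → ℂ) (x q : ℂ) : ℂ := ∑' m : ℕ, f (x * q ^ m)

section lambert

variable {f : ℂ → ℂ} {x q : ℂ}

theorem norm_mul_pow_le (hq : ‖q‖ ≤ 1 / 2) (m : ℕ) : ‖x * q ^ m‖ ≤ ‖x‖ * (1 / 2) ^ m := by
  rw [norm_mul, norm_pow]
  gcongr

theorem IsSmall.norm_term_le (hf : IsSmall f) (hx : ‖x‖ ≤ 1 / 2) (hq : ‖q‖ ≤ 1 / 2) (m : ℕ) :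
    ‖f (x * q ^ m)‖ ≤ 12 * ‖x‖ * (1 / 2) ^ m := by
  have h := norm_mul_pow_le (x := x) hq m
  have h1 : ‖x‖ * (1 / 2 : ℝ) ^ m ≤ ‖x‖ :=
    mul_le_of_le_one_right (norm_nonneg _) (pow_le_one₀ (by norm_num) (by norm_num))
  have := hf.bound _ (h.trans (h1.trans hx))
  linarith

theorem IsSmall.summable (hf : IsSmall f) (hx : ‖x‖ ≤ 1 / 2) (hq : ‖q‖ ≤ 1 / 2) :
    Summable fun m : ℕ => f (x * q ^ m) :=
  .of_norm_bounded (summable_geometric_two.mul_left _) (hf.norm_term_le hx hq)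

theorem IsSmall.hasSum (hf : IsSmall f) (hx : ‖x‖ ≤ 1 / 2) (hq : ‖q‖ ≤ 1 / 2) :
    HasSum (fun m : ℕ => f (x * q ^ m)) (lambert f x q) :=
  (hf.summable hx hq).hasSum

theorem IsSmall.norm_lambert_le (hf : IsSmall f) (hx : ‖x‖ ≤ 1 / 2) (hq : ‖q‖ ≤ 1 / 2) :
    ‖lambert f x q‖ ≤ 24 * ‖x‖ := by
  have h := tsum_of_norm_bounded (hasSum_geometric_two.mul_left (12 * ‖x‖))
    (hf.norm_term_le hx hq)
  rw [lambert]
  linarith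

theorem IsSmall.lambert_eq (hf : IsSmall f) (hx : ‖x‖ ≤ 1 / 2) (hq : ‖q‖ ≤ 1 / 2) :
    lambert f x q = f x + lambert f (x * q) q := by
  rw [lambert, (hf.summable hx hq).tsum_eq_zero_add, lambert]
  simp only [pow_zero, mul_one, pow_succ']
  simp only [mul_assoc]

theorem conj_lambert_geom₁ : (starRingEnd ℂ) (lambert geom₁ x q) =
    lambert geom₁ ((starRingEnd ℂ) x) ((starRingEnd ℂ) q) := by
  simp [lambert, geom₁, Complex.conj_tsum]

end lambert

theorem eventually_norm_le_half {x : ℂ → ℂ} (hx : Tendsto x vertInfty (𝓝 0)) :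
    ∀ᶠ τ in vertInfty, ‖x τ‖ ≤ 1 / 2 := by
  filter_upwards [(Metric.tendsto_nhds.1 hx) (1 / 2) (by norm_num)] with τ h
  rw [dist_zero_right] at h
  exact h.le

/-- On a unit disc high in the strip the terms are dominated by a geometric series, so the sum
converges uniformly there and is holomorphic. -/
theorem IsSmall.eventually_differentiableAt_lambert {f x q : ℂ → ℂ} (hf : IsSmall f)
    (hx : Tendsto x vertInfty (𝓝 0)) (hq : Tendsto q vertInfty (𝓝 0))
    (hxd : Differentiable ℂ x) (hqd : Differentiable ℂ q) :
    ∀ᶠ τ in vertInfty, DifferentiableAt ℂ (fun σ => lambert f (x σ) (q σ)) τ := by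
  filter_upwards [eventually_vertInfty_closedBall (eventually_norm_le_half hx),
    eventually_vertInfty_closedBall (eventually_norm_le_half hq)] with τ h1 h2
  have key : DifferentiableOn ℂ (fun σ => ∑' m : ℕ, f (x σ * q σ ^ m)) (ball τ 1) := by
    refine Complex.differentiableOn_tsum_of_summable_norm
      (summable_geometric_two.mul_left (12 * (1 / 2 : ℝ))) (fun m => ?_) isOpen_ball
      fun m σ hσ => ?_
    · refine hf.diff.comp (t := ball 0 1) (by fun_prop) fun σ hσ => ?_
      have hσ' := ball_subset_closedBall hσ
      rw [mem_ball_zero_iff]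
      refine (norm_mul_pow_le (h2 σ hσ') m).trans_lt ?_
      have : (1 / 2 : ℝ) ^ m ≤ 1 := pow_le_one₀ (by norm_num) (by norm_num)
      have := h1 σ hσ'
      nlinarith [norm_nonneg (x σ)]
    · have hσ' := ball_subset_closedBall hσ
      refine (hf.norm_term_le (h1 σ hσ') (h2 σ hσ') m).trans ?_
      have := h1 σ hσ'
      gcongr
  exact key.differentiableAt (ball_mem_nhds τ one_pos)

theorem IsSmall.tendsto_lambert_div {f x q v : ℂ → ℂ} (hf : IsSmall f)
    (hx : Tendsto x vertInfty (𝓝 0)) (hq : Tendsto q vertInfty (𝓝 0))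
    (hv : Tendsto (fun τ => x τ / v τ) vertInfty (𝓝 0)) :
    Tendsto (fun τ => lambert f (x τ) (q τ) / v τ) vertInfty (𝓝 0) := by
  have hv' := (hv.norm.const_mul 24)
  rw [norm_zero, mul_zero] at hv'
  refine squeeze_zero_norm' ?_ hv'
  filter_upwards [eventually_norm_le_half hx, eventually_norm_le_half hq] with τ h1 h2
  rw [norm_div, norm_div, ← mul_div_assoc]
  gcongr
  exact hf.norm_lambert_le h1 h2

/-! ### Sums over `ℤ`: the rows of the lattice sums. -/

/-- `e^{2πi w}`. -/
def qexp (w : ℂ) : ℂ := Complex.exp (2 * Real.pi * Complex.I * w)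

theorem qexp_add (v w : ℂ) : qexp (v + w) = qexp v * qexp w := by
  simp [qexp, mul_add, Complex.exp_add]

theorem qexp_nat_mul (n : ℕ) (w : ℂ) : qexp (n * w) = qexp w ^ n := by
  rw [qexp, qexp, ← Complex.exp_nat_mul]
  congr 1
  ring

theorem norm_qexp (w : ℂ) : ‖qexp w‖ = Real.exp (-(2 * Real.pi * w.im)) := by
  rw [qexp, Complex.norm_exp]
  simp

theorem im_pos_of_norm_qexp_lt {w : ℂ} (h : ‖qexp w‖ < 1) : 0 < w.im := by
  rw [norm_qexp, Real.exp_lt_one_iff] at h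
  have := Real.pi_pos
  by_contra h'
  nlinarith

theorem norm_qexp_lt_one {w : ℂ} (h : 0 < w.im) : ‖qexp w‖ < 1 := by
  rw [norm_qexp, Real.exp_lt_one_iff]
  have := Real.pi_pos
  nlinarith

/-- `∑_{n ∈ ℤ} 1 / (w + n) ^ 2`, omitting an infinite summand. -/
def rowTwo (w : ℂ) : ℂ := ∑' n : ℤ, 1 / (w + n) ^ 2

/-- `∑_{n ∈ ℤ} 1 / (w + n) ^ 3`, omitting an infinite summand. -/
def rowThree (w : ℂ) : ℂ := ∑' n : ℤ, 1 / (w + n) ^ 3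

/-- `π cot(π w)`, with the value `0` at the integers. -/
def cotPi (w : ℂ) : ℂ := Real.pi * Complex.cot (Real.pi * w)

theorem summable_one_div_add_int_pow (w : ℂ) {k : ℕ} (hk : 2 ≤ k) :
    Summable fun n : ℤ => 1 / (w + n) ^ k := by
  refine (EisensteinSeries.linear_right_summable w 1 (k := k) (by lia)).congr fun n => ?_
  simp

theorem hasSum_rowTwo (w : ℂ) : HasSum (fun n : ℤ => 1 / (w + n) ^ 2) (rowTwo w) :=
  (summable_one_div_add_int_pow w le_rfl).hasSum

theorem hasSum_rowThree (w : ℂ) : HasSum (fun n : ℤ => 1 / (w + n) ^ 3) (rowThree w) :=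
  (summable_one_div_add_int_pow w (by norm_num)).hasSum

theorem rowTwo_neg (w : ℂ) : rowTwo (-w) = rowTwo w := by
  rw [rowTwo, rowTwo, ← (Equiv.neg ℤ).tsum_eq]
  refine tsum_congr fun n => ?_
  simp only [Equiv.neg_apply, Int.cast_neg]
  rw [← neg_add, neg_sq]

theorem rowThree_neg (w : ℂ) : rowThree (-w) = -rowThree w := by
  rw [rowThree, rowThree, ← (Equiv.neg ℤ).tsum_eq, ← tsum_neg]
  refine tsum_congr fun n => ?_
  simp only [Equiv.neg_apply, Int.cast_neg]
  rw [← neg_add, Odd.neg_pow (by decide), div_neg]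

theorem cotPi_neg (w : ℂ) : cotPi (-w) = -cotPi w := by
  simp [cotPi, Complex.cot, div_neg]

theorem hasSum_geom₂ {x : ℂ} (hx : ‖x‖ < 1) :
    HasSum (fun n : ℕ => (n : ℂ) ^ 2 * x ^ n) (geom₂ x) := by
  have h2 := (hasSum_choose_mul_geometric_of_norm_lt_one 2 hx).mul_left 2
  have h1 := (hasSum_coe_mul_geometric_of_norm_lt_one hx).mul_left 3
  have h0 := (hasSum_geometric_of_norm_lt_one hx).mul_left 2
  have hne := one_sub_ne_zero_of_norm_lt hx
  have h3 := (h2.sub h1).sub h0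
  have h4 : 2 * (1 / (1 - x) ^ (2 + 1)) - 3 * (x / (1 - x) ^ 2) - 2 * (1 - x)⁻¹ = geom₂ x := by
    rw [geom₂]
    field_simp
    ring
  rw [h4] at h3
  refine h3.congr_fun fun n => ?_
  rw [Nat.cast_choose_two]
  push_cast
  ring

theorem rowTwo_eq {w : ℂ} (hw : 0 < w.im) :
    rowTwo w = (2 * Real.pi * Complex.I) ^ 2 * geom₁ (qexp w) := by
  have h := EisensteinSeries.qExpansion_identity (k := 1) le_rfl ⟨w, hw⟩
  have h1 := tsum_coe_mul_geometric_of_norm_lt_one (norm_qexp_lt_one hw)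
  simp only [pow_one, Nat.factorial_one, Nat.cast_one, div_one] at h
  rw [qexp] at h1
  rw [rowTwo]
  refine h.trans ?_
  rw [h1, geom₁, qexp]
  ring

theorem rowThree_eq {w : ℂ} (hw : 0 < w.im) :
    rowThree w = -((2 * Real.pi * Complex.I) ^ 3 / 2) * geom₂ (qexp w) := by
  have h := EisensteinSeries.qExpansion_identity (k := 2) one_le_two ⟨w, hw⟩
  have h1 := (hasSum_geom₂ (norm_qexp_lt_one hw)).tsum_eq
  rw [qexp] at h1
  rw [rowThree]
  refine h.trans ?_
  change _ * (∑' n : ℕ, (n : ℂ) ^ 2 * Complex.exp (2 * Real.pi * Complex.I * w) ^ n) = _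
  rw [h1, qexp]
  norm_num [Nat.factorial]
  ring

theorem cotPi_eq {w : ℂ} (hw : 0 < w.im) :
    cotPi w = -(Real.pi * Complex.I) - 2 * Real.pi * Complex.I * geom₀ (qexp w) := by
  have h := pi_mul_cot_pi_q_exp ⟨w, hw⟩
  have h1 := tsum_geometric_of_norm_lt_one (norm_qexp_lt_one hw)
  have hne := one_sub_ne_zero_of_norm_lt (norm_qexp_lt_one hw)
  rw [qexp] at h1 hne
  rw [cotPi]
  refine h.trans ?_
  change _ - _ * (∑' n : ℕ, Complex.exp (2 * Real.pi * Complex.I * w) ^ n) = _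
  rw [h1, geom₀, qexp]
  generalize Complex.exp (2 * Real.pi * Complex.I * w) = x at hne
  field_simp
  ring

theorem hasSum_one_div_nat_sq :
    HasSum (fun n : ℕ => (1 : ℂ) / (n : ℂ) ^ 2) ((Real.pi : ℂ) ^ 2 / 6) := by
  have := Complex.hasSum_ofReal.2 hasSum_zeta_two
  push_cast at this
  exact this

theorem rowTwo_zero : rowTwo 0 = Real.pi ^ 2 / 3 := by
  have h := hasSum_one_div_nat_sq
  have h2 := HasSum.of_nat_of_neg (f := fun n : ℤ => 1 / ((0 : ℂ) + n) ^ 2)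
    (by simpa using h) (by simpa using h)
  rw [rowTwo, h2.tsum_eq]
  simp
  ring

/-- `1/(1/2+n)² = 4/(2n+1)²`, and the odd squares contribute three quarters of `ζ(2)`, once for `n ≥
0` and once for `n < 0`. -/
theorem rowTwo_half : rowTwo (1 / 2) = Real.pi ^ 2 := by
  have h := hasSum_one_div_nat_sq
  have he : HasSum (fun n : ℕ => 1 / ((2 * n : ℕ) : ℂ) ^ 2) (1 / 4 * ((Real.pi : ℂ) ^ 2 / 6)) := by
    refine (h.mul_left (1 / 4)).congr_fun fun n => ?_
    push_cast
    rw [mul_pow, one_div_mul_one_div]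
    norm_num
  have ho : HasSum (fun n : ℕ => 1 / ((2 * n + 1 : ℕ) : ℂ) ^ 2)
      (∑' n : ℕ, 1 / ((2 * n + 1 : ℕ) : ℂ) ^ 2) := by
    have hinj : Function.Injective fun n : ℕ => 2 * n + 1 := fun a b hab => by simpa using hab
    exact (h.summable.comp_injective hinj).hasSum
  have ho' := (HasSum.even_add_odd (f := fun n : ℕ => 1 / (n : ℂ) ^ 2) he ho).unique h
  rw [← eq_sub_iff_add_eq'] at ho'
  rw [ho'] at ho
  have h2 : HasSum (fun n : ℕ => 1 / ((1 / 2 : ℂ) + (n : ℤ)) ^ 2)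
      (4 * ((Real.pi : ℂ) ^ 2 / 6 - 1 / 4 * ((Real.pi : ℂ) ^ 2 / 6))) := by
    refine (ho.mul_left 4).congr_fun fun n => ?_
    push_cast
    rw [show 2 * (n : ℂ) + 1 = 2 * (1 / 2 + n) by ring, mul_pow, ← one_div_mul_one_div]
    ring
  have h3 : HasSum (fun n : ℕ => 1 / ((1 / 2 : ℂ) + (-(n + 1 : ℤ) : ℤ)) ^ 2)
      (4 * ((Real.pi : ℂ) ^ 2 / 6 - 1 / 4 * ((Real.pi : ℂ) ^ 2 / 6))) := by
    refine (ho.mul_left 4).congr_fun fun n => ?_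
    push_cast
    rw [show 2 * (n : ℂ) + 1 = (-2) * (1 / 2 + -(n + 1)) by ring, mul_pow,
      ← one_div_mul_one_div]
    ring
  have h4 := HasSum.of_nat_of_neg_add_one (f := fun n : ℤ => 1 / ((1 / 2 : ℂ) + n) ^ 2) h2 h3
  rw [rowTwo, h4.tsum_eq]
  ring

theorem HasSum.int_pairs {f : ℤ → ℂ} {a : ℂ} (h : HasSum f a) :
    HasSum (fun n : ℕ => f (n + 1) + f (-(n + 1))) (a - f 0) := by
  -- `nat_add_neg` counts `f 0` twice, with total `a + f 0`; removing its term at `0` leaves `a - f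
  -- 0`.
  have h1 := (hasSum_nat_add_iff' 1).2 h.nat_add_neg
  simpa [add_sub_add_right_eq_sub] using h1

/-- The Mittag-Leffler series of `π cot`, convergent once `n` and `-n` are paired. At `w = 0` every
pair cancels and the conventions `cot 0 = 0`, `1/0 = 0` make the right side vanish; this serves the
row through the origin. -/
theorem hasSum_cotPi {w : ℂ} (hw : w ∈ Complex.integerComplement ∨ w = 0) :
    HasSum (fun n : ℕ => 1 / (w - (n + 1)) + 1 / (w + (n + 1))) (cotPi w - 1 / w) := by
  rcases hw with hw | rfl
  · rw [cotPi, cot_series_rep' hw]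
    exact (summable_cotTerm hw).hasSum
  · have : cotPi 0 = 0 := by simp [cotPi, Complex.cot]
    rw [this]
    convert hasSum_zero (α := ℂ) (β := ℕ) using 1
    · ext n
      rw [zero_sub, zero_add, div_neg]
      ring
    · simp

theorem tsum_zeta_row {z w w₀ : ℂ} (hw : w ∈ Complex.integerComplement)
    (hw₀ : w₀ ∈ Complex.integerComplement ∨ w₀ = 0)
    (h : Summable fun n : ℤ => 1 / (w - n) + 1 / (w₀ + n) + z / (w₀ + n) ^ 2) :
    ∑' n : ℤ, (1 / (w - n) + 1 / (w₀ + n) + z / (w₀ + n) ^ 2) =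
      cotPi w + cotPi w₀ + z * rowTwo w₀ := by
  have h1 := HasSum.int_pairs h.hasSum
  have h2 := HasSum.int_pairs ((hasSum_rowTwo w₀).mul_left z)
  have h3 := ((hasSum_cotPi (Or.inl hw)).add (hasSum_cotPi hw₀)).add h2
  have h4 := h1.unique (h3.congr_fun fun n => ?_)
  · simp only [Int.cast_zero, add_zero, sub_zero] at h4
    linear_combination h4
  · push_cast
    ring

/-! ### Summing over the lattice row by row. -/

variable (τ : ℍ)

theorem hasSum_lattice_rows {f : ℂ → ℂ} {a : ℂ}
    (h : HasSum (fun l : (periods τ).lattice => f l) a) :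
    (∀ m : ℤ, Summable fun n : ℤ => f (n + m * τ)) ∧
      HasSum (fun m : ℤ => ∑' n : ℤ, f (n + m * τ)) a := by
  have h1 : HasSum (fun p : ℤ × ℤ => f (p.2 + p.1 * τ)) a := by
    have h2 := (((Equiv.prodComm ℤ ℤ).trans
      (periods τ).latticeEquivProd.symm.toEquiv).hasSum_iff).2 h
    convert h2 using 1
    ext p
    simp only [Function.comp, Equiv.trans_apply, Equiv.prodComm_apply]
    congr 1
    refine Eq.trans ?_ ((periods τ).latticeEquiv_symm_apply p.swap).symm
    simp [periods]
  have h3 : ∀ m : ℤ, Summable fun n : ℤ => f (n + m * τ) := fun m => h1.summable.prod_factor m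
  exact ⟨h3, h1.prod_fiberwise fun m => (h3 m).hasSum⟩

theorem hasSum_wp_rows (z : ℂ) :
    HasSum (fun m : ℤ => rowTwo (z - m * τ) - rowTwo (m * τ)) (wp τ z) := by
  have h := (hasSum_lattice_rows τ (f := fun l => 1 / (z - l) ^ 2 - 1 / l ^ 2)
    ((periods τ).hasSum_weierstrassP z)).2
  refine h.congr_fun fun m => ?_
  have h1 := hasSum_rowTwo (z - m * τ)
  rw [← (Equiv.neg ℤ).hasSum_iff] at h1
  refine ((h1.sub (hasSum_rowTwo (m * τ))).congr_fun fun n => ?_).tsum_eq.symm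
  simp only [Function.comp, Equiv.neg_apply, Int.cast_neg]
  congr 2 <;> ring

theorem hasSum_wpDeriv_rows (z : ℂ) :
    HasSum (fun m : ℤ => -2 * rowThree (z - m * τ)) (wpDeriv τ z) := by
  have h := (hasSum_lattice_rows τ (f := fun l => -2 / (z - l) ^ 3) (a := wpDeriv τ z) ?_).2
  · refine h.congr_fun fun m => ?_
    have h1 := hasSum_rowThree (z - m * τ)
    rw [← (Equiv.neg ℤ).hasSum_iff] at h1
    refine ((h1.mul_left (-2)).congr_fun fun n => ?_).tsum_eq.symm
    simp only [Function.comp, Equiv.neg_apply, Int.cast_neg]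
    rw [mul_one_div]
    congr 2
    ring
  · refine ((periods τ).hasSum_derivWeierstrassP z).congr_fun fun l => ?_
    simp [neg_div]

theorem summable_wZeta (z : ℂ) :
    Summable fun l : (periods τ).lattice => 1 / (z - l) + 1 / (l : ℂ) + z / (l : ℂ) ^ 2 := by
  set L := (periods τ).lattice
  have hsum : Summable fun l : L => 2 * ‖z‖ ^ 2 * ‖l‖⁻¹ ^ 3 :=
    (ZLattice.summable_norm_pow_inv L 3 (by simp [L])).mul_left _
  refine Summable.of_norm_bounded_eventually hsum ?_
  refine (isCompact_iff_finite.mp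
    (isCompact_closedBall (0 : (periods τ).lattice) (2 * ‖z‖ + 1))).subset ?_
  intro l hl
  rw [mem_closedBall, dist_zero_right]
  by_contra! hlt
  refine hl ?_
  change ‖1 / (z - (l : ℂ)) + 1 / (l : ℂ) + z / (l : ℂ) ^ 2‖ ≤ 2 * ‖z‖ ^ 2 * ‖(l : ℂ)‖⁻¹ ^ 3
  change 2 * ‖z‖ + 1 < ‖(l : ℂ)‖ at hlt
  have hz := norm_nonneg z
  have hl0 : 0 < ‖(l : ℂ)‖ := by linarith
  have hl1 : (l : ℂ) ≠ 0 := norm_pos_iff.1 hl0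
  have hzl : ‖(l : ℂ)‖ / 2 ≤ ‖z - l‖ := by
    have := norm_sub_norm_le (l : ℂ) z
    rw [norm_sub_rev] at this
    linarith
  have hzl1 : z - l ≠ 0 := norm_pos_iff.1 (by linarith)
  -- The correction terms leave decay of order `|l|⁻³`, which is summable over a lattice of rank
  -- two.
  have e : 1 / (z - (l : ℂ)) + 1 / (l : ℂ) + z / (l : ℂ) ^ 2 =
      z ^ 2 / ((l : ℂ) ^ 2 * (z - l)) := by
    field_simp
    ring
  rw [e, norm_div, norm_mul, norm_pow, norm_pow]
  calc ‖z‖ ^ 2 / (‖(l : ℂ)‖ ^ 2 * ‖z - l‖) ≤ ‖z‖ ^ 2 / (‖(l : ℂ)‖ ^ 2 * (‖(l : ℂ)‖ / 2)) := by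
        gcongr
    _ = 2 * ‖z‖ ^ 2 * ‖(l : ℂ)‖⁻¹ ^ 3 := by field_simp

theorem hasSum_wZeta_rows {z : ℂ} (hz : ∀ m : ℤ, z - m * τ ∈ Complex.integerComplement) :
    HasSum (fun m : ℤ => cotPi (z - m * τ) + cotPi (m * τ) + z * rowTwo (m * τ)) (wZeta τ z) := by
  have h0 : HasSum (fun l : (periods τ).lattice =>
      1 / (z - l) + 1 / (l : ℂ) + z / (l : ℂ) ^ 2) (wZeta τ z) := (summable_wZeta τ z).hasSum
  obtain ⟨hs, h⟩ := hasSum_lattice_rows τ (f := fun l => 1 / (z - l) + 1 / l + z / l ^ 2) h0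
  refine h.congr_fun fun m => ?_
  have e : ∀ n : ℤ, 1 / (z - (n + m * τ)) + 1 / (n + m * τ) + z / (n + m * τ : ℂ) ^ 2 =
      1 / (z - m * τ - n) + 1 / (m * τ + n) + z / (m * τ + n : ℂ) ^ 2 := fun n => by
    rw [add_comm (n : ℂ), sub_sub]
  have hw : (m * τ : ℂ) ∈ Complex.integerComplement ∨ (m * τ : ℂ) = 0 := by
    by_cases hm : m = 0
    · right
      rw [hm, Int.cast_zero, zero_mul]
    · left
      rw [Complex.mem_integerComplement_iff]
      rintro ⟨n, hn⟩
      have := congrArg Complex.im hn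
      simp [hm, τ.im_pos.ne'] at this
  have hs' : Summable fun n : ℤ =>
      1 / (z - m * τ - n) + 1 / (m * τ + n) + z / (m * τ + n : ℂ) ^ 2 :=
    (hs m).congr fun n => e n
  exact ((tsum_congr e).trans (tsum_zeta_row (hz m) hw hs')).symm

/-! ### `q`-expansions of `℘`, `℘'`, `ζ` and the quasi-periods. -/

theorem im_nat_mul_add_pos {a b : ℂ} (n : ℕ) (hb : 0 < b.im) (ha : 0 < (b + a).im) :
    0 < ((n + 1) * b + a).im := by
  have : ((n + 1) * b + a).im = n * b.im + (b + a).im := by simp; ring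
  rw [this]
  positivity

theorem qexp_succ_mul_add (a b : ℂ) (n : ℕ) :
    qexp ((n + 1) * b + a) = qexp (b + a) * qexp b ^ n := by
  rw [← qexp_nat_mul, ← qexp_add]
  congr 1
  ring

theorem im_succ_mul_add_pos {a b : ℂ} (n : ℕ) (hb : ‖qexp b‖ ≤ 1 / 2)
    (ha : ‖qexp (b + a)‖ ≤ 1 / 2) : 0 < ((n + 1) * b + a).im :=
  im_nat_mul_add_pos n (im_pos_of_norm_qexp_lt (hb.trans_lt (by norm_num)))
    (im_pos_of_norm_qexp_lt (ha.trans_lt (by norm_num)))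

theorem rowTwo_succ_mul_add {a b : ℂ} (n : ℕ) (hb : ‖qexp b‖ ≤ 1 / 2)
    (ha : ‖qexp (b + a)‖ ≤ 1 / 2) : rowTwo ((n + 1) * b + a) =
      (2 * Real.pi * Complex.I) ^ 2 * geom₁ (qexp (b + a) * qexp b ^ n) := by
  rw [rowTwo_eq (im_succ_mul_add_pos n hb ha), qexp_succ_mul_add]

theorem rowTwo_succ_mul {b : ℂ} (n : ℕ) (hb : ‖qexp b‖ ≤ 1 / 2) : rowTwo ((n + 1) * b) =
      (2 * Real.pi * Complex.I) ^ 2 * geom₁ (qexp b * qexp b ^ n) := by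
  have := rowTwo_succ_mul_add (a := 0) n hb (by rwa [add_zero])
  rwa [add_zero, add_zero] at this

/-- The rows `±m` with `m ≥ 1` are moved into the upper half plane by parity and evaluated by the
Lipschitz formula. The row `m = 0` stays as `rowTwo z`, so that real `z` such as `1/2` is covered.
-/
theorem wp_eq {τ : ℍ} {z : ℂ} (hq : ‖qexp τ‖ ≤ 1 / 2) (hp : ‖qexp (τ + z)‖ ≤ 1 / 2)
    (hm : ‖qexp (τ + -z)‖ ≤ 1 / 2) :
    wp τ z = rowTwo z - rowTwo 0 + (2 * Real.pi * Complex.I) ^ 2 *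
      (lambert geom₁ (qexp (τ + z)) (qexp τ) + lambert geom₁ (qexp (τ + -z)) (qexp τ)
        - 2 * lambert geom₁ (qexp τ) (qexp τ)) := by
  have h1 := HasSum.int_pairs (hasSum_wp_rows τ z)
  have h2 := (((isSmall_geom₁.hasSum hp hq).add (isSmall_geom₁.hasSum hm hq)).sub
    ((isSmall_geom₁.hasSum hq hq).mul_left 2)).mul_left ((2 * Real.pi * Complex.I) ^ 2)
  have h3 : ∀ n : ℕ, rowTwo (z - ((n + 1 : ℤ) : ℂ) * τ) - rowTwo (((n + 1 : ℤ) : ℂ) * τ) +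
      (rowTwo (z - ((-(n + 1) : ℤ) : ℂ) * τ) - rowTwo (((-(n + 1) : ℤ) : ℂ) * τ)) =
      (2 * Real.pi * Complex.I) ^ 2 * (geom₁ (qexp (τ + z) * qexp τ ^ n) +
        geom₁ (qexp (τ + -z) * qexp τ ^ n) - 2 * geom₁ (qexp τ * qexp τ ^ n)) := fun n => by
    push_cast
    rw [show z - (n + 1) * (τ : ℂ) = -((n + 1) * τ + -z) by ring,
      show z - -((n : ℂ) + 1) * (τ : ℂ) = (n + 1) * τ + z by ring,
      show -((n : ℂ) + 1) * (τ : ℂ) = -((n + 1) * τ) by ring, rowTwo_neg, rowTwo_neg,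
      rowTwo_succ_mul_add n hq hp, rowTwo_succ_mul_add n hq hm, rowTwo_succ_mul n hq]
    ring
  have h4 := h1.unique (h2.congr_fun h3)
  simp only [Int.cast_zero, zero_mul, sub_zero] at h4
  linear_combination h4

theorem wpDeriv_eq {τ : ℍ} {z : ℂ} (hq : ‖qexp τ‖ ≤ 1 / 2) (hp : ‖qexp (τ + z)‖ ≤ 1 / 2)
    (hm : ‖qexp (τ + -z)‖ ≤ 1 / 2) (hz : 0 < z.im) :
    wpDeriv τ z = (2 * Real.pi * Complex.I) ^ 3 * (geom₂ (qexp z) +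
      (lambert geom₂ (qexp (τ + z)) (qexp τ) - lambert geom₂ (qexp (τ + -z)) (qexp τ))) := by
  have h1 := HasSum.int_pairs (hasSum_wpDeriv_rows τ z)
  have h2 := ((isSmall_geom₂.hasSum hp hq).sub (isSmall_geom₂.hasSum hm hq)).mul_left
    ((2 * Real.pi * Complex.I) ^ 3)
  have h3 : ∀ n : ℕ, -2 * rowThree (z - ((n + 1 : ℤ) : ℂ) * τ) +
      -2 * rowThree (z - ((-(n + 1) : ℤ) : ℂ) * τ) =
      (2 * Real.pi * Complex.I) ^ 3 * (geom₂ (qexp (τ + z) * qexp τ ^ n) -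
        geom₂ (qexp (τ + -z) * qexp τ ^ n)) := fun n => by
    push_cast
    rw [show z - (n + 1) * (τ : ℂ) = -((n + 1) * τ + -z) by ring,
      show z - -((n : ℂ) + 1) * (τ : ℂ) = (n + 1) * τ + z by ring, rowThree_neg,
      rowThree_eq (im_succ_mul_add_pos n hq hp), rowThree_eq (im_succ_mul_add_pos n hq hm),
      qexp_succ_mul_add, qexp_succ_mul_add]
    ring
  have h4 := h1.unique (h2.congr_fun h3)
  simp only [Int.cast_zero, zero_mul, sub_zero, rowThree_eq hz] at h4
  linear_combination h4

/-- The quasi-period `η₁`, as the Eisenstein series of weight two. -/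
def eisTwo (τ : ℂ) : ℂ :=
  rowTwo 0 + 2 * (2 * Real.pi * Complex.I) ^ 2 * lambert geom₁ (qexp τ) (qexp τ)

theorem wZeta_eq {τ : ℍ} {z : ℂ} (hq : ‖qexp τ‖ ≤ 1 / 2) (hp : ‖qexp (τ + z)‖ ≤ 1 / 2)
    (hm : ‖qexp (τ + -z)‖ ≤ 1 / 2) (hz : z ∈ Complex.integerComplement) :
    wZeta τ z = cotPi z + z * eisTwo τ - 2 * Real.pi * Complex.I *
      (lambert geom₀ (qexp (τ + z)) (qexp τ) - lambert geom₀ (qexp (τ + -z)) (qexp τ)) := by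
  -- The bounds `hp` and `hm` give `|Im z| < Im τ`, so `z - mτ` can be real only for `m = 0`, the
  -- case excluded by `hz`.
  have hrow : ∀ m : ℤ, z - m * τ ∈ Complex.integerComplement := by
    intro m
    rw [Complex.mem_integerComplement_iff]
    rintro ⟨k, hk⟩
    have hi := congrArg Complex.im hk
    simp only [Complex.intCast_im, Complex.sub_im, Complex.mul_im, Complex.intCast_re,
      zero_mul, add_zero] at hi
    have i1 := im_pos_of_norm_qexp_lt (hp.trans_lt (by norm_num))
    have i2 := im_pos_of_norm_qexp_lt (hm.trans_lt (by norm_num))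
    simp only [Complex.add_im, Complex.neg_im] at i1 i2
    have it : 0 < (τ : ℂ).im := τ.im_pos
    rcases lt_trichotomy m 0 with h | h | h
    · have : (m : ℝ) ≤ -1 := by exact_mod_cast (by lia : m ≤ -1)
      nlinarith
    · subst h
      refine (Complex.mem_integerComplement_iff.1 hz) ⟨k, ?_⟩
      simpa using hk
    · have : (1 : ℝ) ≤ m := by exact_mod_cast h
      nlinarith
  have h1 := HasSum.int_pairs (hasSum_wZeta_rows τ hrow)
  have h2 := (((isSmall_geom₀.hasSum hp hq).sub (isSmall_geom₀.hasSum hm hq)).mul_left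
    (-(2 * Real.pi * Complex.I))).add ((isSmall_geom₁.hasSum hq hq).mul_left
      (2 * z * (2 * Real.pi * Complex.I) ^ 2))
  have h3 : ∀ n : ℕ, cotPi (z - ((n + 1 : ℤ) : ℂ) * τ) + cotPi (((n + 1 : ℤ) : ℂ) * τ) +
      z * rowTwo (((n + 1 : ℤ) : ℂ) * τ) +
      (cotPi (z - ((-(n + 1) : ℤ) : ℂ) * τ) + cotPi (((-(n + 1) : ℤ) : ℂ) * τ) +
      z * rowTwo (((-(n + 1) : ℤ) : ℂ) * τ)) =
      -(2 * Real.pi * Complex.I) * (geom₀ (qexp (τ + z) * qexp τ ^ n) -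
        geom₀ (qexp (τ + -z) * qexp τ ^ n)) +
      2 * z * (2 * Real.pi * Complex.I) ^ 2 * geom₁ (qexp τ * qexp τ ^ n) := fun n => by
    push_cast
    rw [show z - (n + 1) * (τ : ℂ) = -((n + 1) * τ + -z) by ring,
      show z - -((n : ℂ) + 1) * (τ : ℂ) = (n + 1) * τ + z by ring,
      show -((n : ℂ) + 1) * (τ : ℂ) = -((n + 1) * τ) by ring, rowTwo_neg, cotPi_neg, cotPi_neg,
      cotPi_eq (im_succ_mul_add_pos n hq hp), cotPi_eq (im_succ_mul_add_pos n hq hm),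
      rowTwo_succ_mul n hq, qexp_succ_mul_add, qexp_succ_mul_add]
    ring
  have h4 := h1.unique (h2.congr_fun h3)
  have h5 : cotPi 0 = 0 := by simp [cotPi, Complex.cot]
  simp only [Int.cast_zero, zero_mul, sub_zero, h5] at h4
  rw [eisTwo]
  linear_combination h4

theorem half_mem_integerComplement : (1 / 2 : ℂ) ∈ Complex.integerComplement := by
  rw [Complex.mem_integerComplement_iff]
  rintro ⟨n, hn⟩
  have h : ((2 * n : ℤ) : ℂ) = (1 : ℤ) := by
    push_cast
    rw [hn]
    norm_num
  have := Int.cast_injective h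
  lia

theorem neg_mem_integerComplement {z : ℂ} (hz : z ∈ Complex.integerComplement) :
    -z ∈ Complex.integerComplement := by
  rw [Complex.mem_integerComplement_iff] at hz ⊢
  rintro ⟨n, hn⟩
  exact hz ⟨-n, by simp [hn]⟩

theorem mem_integerComplement_of_im_pos {z : ℂ} (hz : 0 < z.im) :
    z ∈ Complex.integerComplement :=
  UpperHalfPlane.coe_mem_integerComplement ⟨z, hz⟩

theorem qexp_half : qexp (1 / 2) = -1 := by
  rw [qexp, ← Complex.exp_pi_mul_I]
  congr 1
  ring

theorem qexp_neg_half : qexp (-(1 / 2)) = -1 := by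
  rw [qexp, show 2 * Real.pi * Complex.I * -(1 / 2) = -(Real.pi * Complex.I) by ring,
    Complex.exp_neg, Complex.exp_pi_mul_I]
  norm_num

/-- At `z = ±1/2` the cotangent vanishes and the two Lambert series coincide, leaving only the term
linear in `z`. -/
theorem eta₁_eq {τ : ℍ} (hq : ‖qexp τ‖ ≤ 1 / 2) : eta₁ τ = eisTwo τ := by
  have h1 : ‖qexp (τ + 1 / 2)‖ ≤ 1 / 2 := by
    rw [qexp_add, qexp_half, norm_mul, norm_neg, norm_one, mul_one]; exact hq
  have h2 : ‖qexp (τ + -(1 / 2))‖ ≤ 1 / 2 := by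
    rw [qexp_add, qexp_neg_half, norm_mul, norm_neg, norm_one, mul_one]; exact hq
  rw [eta₁, wZeta_eq hq h1 h2 half_mem_integerComplement,
    wZeta_eq hq h2 (by rw [neg_neg]; exact h1)
      (neg_mem_integerComplement half_mem_integerComplement), neg_neg, cotPi_neg]
  have h3 : cotPi (1 / 2) = 0 := by
    rw [cotPi, Complex.cot, mul_one_div, Complex.cos_pi_div_two]
    simp
  rw [h3, qexp_add, qexp_add, qexp_half, qexp_neg_half]
  ring

/-- Legendre's relation. At `z = τ/2` the two Lambert series differ by their first term `geom₀ (qexp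
(τ/2))`, which cancels against the cotangent up to `-πi` for each endpoint. -/
theorem eta₂_eq {τ : ℍ} (hq : ‖qexp (τ / 2)‖ ≤ 1 / 2) :
    eta₂ τ = τ * eisTwo τ - 2 * Real.pi * Complex.I := by
  have e1 : (τ : ℂ) + -(τ / 2) = τ / 2 := by ring
  have hsq : qexp τ = qexp (τ / 2) * qexp (τ / 2) := by
    rw [← qexp_add, add_halves]
  have hn := norm_nonneg (qexp (τ / 2))
  have hq' : ‖qexp τ‖ ≤ 1 / 2 := by
    rw [hsq, norm_mul]; nlinarith
  have h1 : ‖qexp (τ + τ / 2)‖ ≤ 1 / 2 := by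
    rw [qexp_add, norm_mul]; nlinarith [norm_nonneg (qexp τ)]
  have h2 : ‖qexp (τ + -(τ / 2))‖ ≤ 1 / 2 := by rw [e1]; exact hq
  have hi : 0 < ((τ : ℂ) / 2).im := im_pos_of_norm_qexp_lt (hq.trans_lt (by norm_num))
  have hz := mem_integerComplement_of_im_pos hi
  rw [eta₂, wZeta_eq hq' h1 h2 hz, wZeta_eq hq' h2 (by rw [neg_neg]; exact h1)
      (neg_mem_integerComplement hz), neg_neg, cotPi_neg, e1, cotPi_eq hi,
      isSmall_geom₀.lambert_eq hq hq', qexp_add, mul_comm (qexp τ)]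
  ring

/-- The multiples of `eisTwo τ` cancel; Legendre's relation contributes `2πi s` and the cotangent
`-πi`, whence the constant `s - 1/2`. -/
theorem Z_eq {r s : ℂ} {τ : ℍ} (hq : ‖qexp (τ / 2)‖ ≤ 1 / 2)
    (hp : ‖qexp (τ + (r + s * τ))‖ ≤ 1 / 2) (hm : ‖qexp (τ + -(r + s * τ))‖ ≤ 1 / 2)
    (hz : 0 < (r + s * τ).im) :
    Z r s τ = 2 * Real.pi * Complex.I * (s - 1 / 2 - geom₀ (qexp (r + s * τ)) -
      (lambert geom₀ (qexp (τ + (r + s * τ))) (qexp τ)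
        - lambert geom₀ (qexp (τ + -(r + s * τ))) (qexp τ))) := by
  have hsq : qexp τ = qexp (τ / 2) * qexp (τ / 2) := by
    rw [← qexp_add, add_halves]
  have hn := norm_nonneg (qexp (τ / 2))
  have hq' : ‖qexp τ‖ ≤ 1 / 2 := by
    rw [hsq, norm_mul]; nlinarith
  rw [Z, wZeta_eq hq' hp hm (mem_integerComplement_of_im_pos hz), eta₁_eq hq', eta₂_eq hq,
    cotPi_eq hz]
  ring

theorem e₁_eq {τ : ℍ} (hq : ‖qexp τ‖ ≤ 1 / 2) :
    e₁ τ = (2 * Real.pi * Complex.I) ^ 2 * (1 / 12 - 1 / 4 +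
      2 * lambert geom₁ (-qexp τ) (qexp τ) - 2 * lambert geom₁ (qexp τ) (qexp τ)) := by
  have h1 : qexp (τ + 1 / 2) = -qexp τ := by rw [qexp_add, qexp_half, mul_neg_one]
  have h2 : qexp (τ + -(1 / 2)) = -qexp τ := by rw [qexp_add, qexp_neg_half, mul_neg_one]
  rw [e₁, wp_eq hq (by rwa [h1, norm_neg]) (by rwa [h2, norm_neg]), h1, h2, rowTwo_half,
    rowTwo_zero, mul_pow, Complex.I_sq]
  ring

theorem wp_eq_of_im_pos {τ : ℍ} {z : ℂ} (hq : ‖qexp τ‖ ≤ 1 / 2) (hp : ‖qexp (τ + z)‖ ≤ 1 / 2)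
    (hm : ‖qexp (τ + -z)‖ ≤ 1 / 2) (hz : 0 < z.im) :
    wp τ z = (2 * Real.pi * Complex.I) ^ 2 * (1 / 12 + geom₁ (qexp z) +
      lambert geom₁ (qexp (τ + z)) (qexp τ) + lambert geom₁ (qexp (τ + -z)) (qexp τ)
        - 2 * lambert geom₁ (qexp τ) (qexp τ)) := by
  rw [wp_eq hq hp hm, rowTwo_eq hz, rowTwo_zero, mul_pow, Complex.I_sq]
  ring

theorem e₂_eq {τ : ℍ} (hq : ‖qexp (τ / 2)‖ ≤ 1 / 2) :
    e₂ τ = (2 * Real.pi * Complex.I) ^ 2 * (1 / 12 + 2 * lambert geom₁ (qexp (τ / 2)) (qexp τ)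
        - 2 * lambert geom₁ (qexp τ) (qexp τ)) := by
  have e1 : (τ : ℂ) + -(τ / 2) = τ / 2 := by ring
  have hsq : qexp τ = qexp (τ / 2) * qexp (τ / 2) := by
    rw [← qexp_add, add_halves]
  have hn := norm_nonneg (qexp (τ / 2))
  have hq' : ‖qexp τ‖ ≤ 1 / 2 := by
    rw [hsq, norm_mul]; nlinarith
  rw [e₂, wp_eq_of_im_pos hq' (by rw [qexp_add, norm_mul]; nlinarith [norm_nonneg (qexp τ)])
    (by rwa [e1]) (im_pos_of_norm_qexp_lt (hq.trans_lt (by norm_num))), e1, qexp_add,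
    isSmall_geom₁.lambert_eq hq hq', mul_comm (qexp τ)]
  ring

theorem e₃_eq {τ : ℍ} (hq : ‖qexp (τ / 2)‖ ≤ 1 / 2) :
    e₃ τ = (2 * Real.pi * Complex.I) ^ 2 * (1 / 12 + 2 * lambert geom₁ (-qexp (τ / 2)) (qexp τ)
        - 2 * lambert geom₁ (qexp τ) (qexp τ)) := by
  have e1 : (τ : ℂ) + -((1 + τ) / 2) = τ / 2 + -(1 / 2) := by ring
  have e2 : (1 + τ : ℂ) / 2 = τ / 2 + 1 / 2 := by ring
  have hsq : qexp τ = qexp (τ / 2) * qexp (τ / 2) := by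
    rw [← qexp_add, add_halves]
  have hn := norm_nonneg (qexp (τ / 2))
  have hq' : ‖qexp τ‖ ≤ 1 / 2 := by
    rw [hsq, norm_mul]; nlinarith
  have hm : qexp (τ + -((1 + τ) / 2)) = -qexp (τ / 2) := by
    rw [e1, qexp_add, qexp_neg_half, mul_neg_one]
  have hz : qexp ((1 + τ) / 2) = -qexp (τ / 2) := by
    rw [e2, qexp_add, qexp_half, mul_neg_one]
  have hzn : ‖qexp ((1 + τ) / 2)‖ ≤ 1 / 2 := by rwa [hz, norm_neg]
  have hq2 : ‖-qexp (τ / 2)‖ ≤ 1 / 2 := by rwa [norm_neg]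
  have hp : ‖qexp (τ + (1 + τ) / 2)‖ ≤ 1 / 2 := by
    rw [qexp_add, norm_mul]
    nlinarith [norm_nonneg (qexp τ), norm_nonneg (qexp ((1 + τ) / 2))]
  rw [e₃, wp_eq_of_im_pos hq' hp (by rwa [hm, norm_neg])
    (im_pos_of_norm_qexp_lt (hzn.trans_lt (by norm_num))), hm,
    qexp_add, hz,
    isSmall_geom₁.lambert_eq hq2 hq', mul_comm (qexp τ)]
  ring

/-! ### Asymptotics of `e₁`, `e₂`, `e₃` and `t`. -/

/-- `2πi`. -/
def twoPiI : ℂ := 2 * Real.pi * Complex.I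

theorem twoPiI_ne_zero : twoPiI ≠ 0 := Complex.two_pi_I_ne_zero

theorem qexp_ne_zero (w : ℂ) : qexp w ≠ 0 := Complex.exp_ne_zero _

theorem qexp_sub (v w : ℂ) : qexp (v - w) = qexp v / qexp w := by
  simp [qexp, mul_sub, Complex.exp_sub]

theorem tendsto_qexp_vertInfty {a : ℂ} (b : ℂ) (ha : 0 < a.re) :
    Tendsto (fun τ : ℂ => qexp (b + a * τ)) vertInfty (𝓝 0) := by
  have h := tendsto_cexp_vertInfty (a := 2 * Real.pi * Complex.I * a)
    (2 * Real.pi * Complex.I * b) (by simp; positivity)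
  refine h.congr fun τ => ?_
  rw [qexp]
  congr 1
  ring

theorem tendsto_qexp : Tendsto qexp vertInfty (𝓝 0) := by
  simpa using tendsto_qexp_vertInfty (a := 1) 0 (by simp)

theorem tendsto_qexp_half : Tendsto (fun τ : ℂ => qexp (τ / 2)) vertInfty (𝓝 0) := by
  have h := tendsto_qexp_vertInfty (a := 1 / 2) 0 (by norm_num)
  refine h.congr fun τ => ?_
  congr 1
  ring

theorem differentiable_qexp : Differentiable ℂ qexp := by
  unfold qexp
  fun_prop

theorem hasDerivAt_qexp (a b τ : ℂ) :
    HasDerivAt (fun σ => qexp (b + a * σ)) (twoPiI * a * qexp (b + a * τ)) τ := by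
  have h : HasDerivAt (fun σ => 2 * Real.pi * Complex.I * (b + a * σ)) (twoPiI * a) τ := by
    have := (((hasDerivAt_id τ).const_mul a).const_add b).const_mul twoPiI
    simpa [twoPiI] using this
  rw [mul_comm (twoPiI * a)]
  exact h.cexp

theorem qexp_half_mul_self (τ : ℂ) : qexp (τ / 2) * qexp (τ / 2) = qexp τ := by
  rw [← qexp_add, add_halves]

theorem IsSmall.tendsto_lambert {f x q : ℂ → ℂ} (hf : IsSmall f)
    (hx : Tendsto x vertInfty (𝓝 0)) (hq : Tendsto q vertInfty (𝓝 0)) :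
    Tendsto (fun τ => lambert f (x τ) (q τ)) vertInfty (𝓝 0) := by
  have := hf.tendsto_lambert_div (v := fun _ => 1) hx hq (by simpa using hx)
  simpa using this

/-- Only the first term counts: the rest is a Lambert series starting at `xq`, hence `O(xq) = o(x)`.
-/
theorem IsSmall.tendsto_lambert_div_self {f x q : ℂ → ℂ} (hf : IsSmall f)
    (hf1 : Tendsto (fun y => f y / y) (𝓝[≠] 0) (𝓝 1))
    (hx : Tendsto x vertInfty (𝓝 0)) (hx0 : ∀ τ, x τ ≠ 0) (hq : Tendsto q vertInfty (𝓝 0)) :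
    Tendsto (fun τ => lambert f (x τ) (q τ) / x τ) vertInfty (𝓝 1) := by
  have h1 : Tendsto (fun τ => f (x τ) / x τ) vertInfty (𝓝 1) :=
    hf1.comp (tendsto_nhdsWithin_iff.2 ⟨hx, Eventually.of_forall hx0⟩)
  have h2 : Tendsto (fun τ => lambert f (x τ * q τ) (q τ) / x τ) vertInfty (𝓝 0) := by
    refine hf.tendsto_lambert_div (by simpa using hx.mul hq) hq (hq.congr fun τ => ?_)
    rw [mul_div_cancel_left₀ _ (hx0 τ)]
  have h3 := h1.add h2
  rw [add_zero] at h3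
  refine h3.congr' ?_
  filter_upwards [eventually_norm_le_half hx, eventually_norm_le_half hq] with τ hxτ hqτ
  rw [hf.lambert_eq hxτ hqτ, add_div]

theorem tendsto_geom₁_div_self : Tendsto (fun y => geom₁ y / y) (𝓝[≠] 0) (𝓝 1) := by
  have h : ContinuousAt (fun y : ℂ => 1 / (1 - y) ^ 2) 0 := by
    fun_prop (disch := norm_num)
  have h1 : Tendsto (fun y : ℂ => 1 / (1 - y) ^ 2) (𝓝[≠] 0) (𝓝 1) := by
    simpa using h.tendsto.mono_left nhdsWithin_le_nhds
  refine h1.congr' ?_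
  filter_upwards [self_mem_nhdsWithin] with y hy
  have hy' : y ≠ 0 := hy
  rw [geom₁]
  field_simp

theorem tendsto_geom₂_div_self : Tendsto (fun y => geom₂ y / y) (𝓝[≠] 0) (𝓝 1) := by
  have h : ContinuousAt (fun y : ℂ => (1 + y) / (1 - y) ^ 3) 0 := by
    fun_prop (disch := norm_num)
  have h1 : Tendsto (fun y : ℂ => (1 + y) / (1 - y) ^ 3) (𝓝[≠] 0) (𝓝 1) := by
    simpa using h.tendsto.mono_left nhdsWithin_le_nhds
  refine h1.congr' ?_
  filter_upwards [self_mem_nhdsWithin] with y hy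
  have hy' : y ≠ 0 := hy
  rw [geom₂]
  field_simp

/-- The `q`-expansion of `e₁`. -/
def E₁ (τ : ℂ) : ℂ := twoPiI ^ 2 * (1 / 12 - 1 / 4 +
  2 * lambert geom₁ (-qexp τ) (qexp τ) - 2 * lambert geom₁ (qexp τ) (qexp τ))

/-- The `q`-expansion of `e₂`. -/
def E₂ (τ : ℂ) : ℂ := twoPiI ^ 2 * (1 / 12 +
  2 * lambert geom₁ (qexp (τ / 2)) (qexp τ) - 2 * lambert geom₁ (qexp τ) (qexp τ))

/-- The `q`-expansion of `e₃`. -/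
def E₃ (τ : ℂ) : ℂ := twoPiI ^ 2 * (1 / 12 +
  2 * lambert geom₁ (-qexp (τ / 2)) (qexp τ) - 2 * lambert geom₁ (qexp τ) (qexp τ))

theorem eventually_differentiableAt_E₁ : ∀ᶠ τ in vertInfty, DifferentiableAt ℂ E₁ τ := by
  have hd := differentiable_qexp
  filter_upwards [isSmall_geom₁.eventually_differentiableAt_lambert tendsto_qexp tendsto_qexp hd hd,
    isSmall_geom₁.eventually_differentiableAt_lambert (x := fun τ => -qexp τ)
      (by simpa using tendsto_qexp.neg) tendsto_qexp hd.neg hd] with τ h1 h2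
  unfold E₁
  fun_prop

theorem differentiable_qexp_half : Differentiable ℂ fun τ : ℂ => qexp (τ / 2) := by
  unfold qexp
  fun_prop

theorem eventually_differentiableAt_E₂ : ∀ᶠ τ in vertInfty, DifferentiableAt ℂ E₂ τ := by
  have hd := differentiable_qexp
  filter_upwards [isSmall_geom₁.eventually_differentiableAt_lambert tendsto_qexp tendsto_qexp hd hd,
    isSmall_geom₁.eventually_differentiableAt_lambert
      tendsto_qexp_half tendsto_qexp differentiable_qexp_half hd] with τ h1 h2
  unfold E₂
  fun_prop

theorem eventually_differentiableAt_E₃ : ∀ᶠ τ in vertInfty, DifferentiableAt ℂ E₃ τ := by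
  have hd := differentiable_qexp
  filter_upwards [isSmall_geom₁.eventually_differentiableAt_lambert tendsto_qexp tendsto_qexp hd hd,
    isSmall_geom₁.eventually_differentiableAt_lambert (x := fun τ => -qexp (τ / 2))
      (by simpa using tendsto_qexp_half.neg) tendsto_qexp differentiable_qexp_half.neg hd]
    with τ h1 h2
  unfold E₃
  fun_prop

theorem tendsto_E₂_sub_E₁ :
    Tendsto (fun τ => E₂ τ - E₁ τ) vertInfty (𝓝 (twoPiI ^ 2 / 4)) := by
  have h1 := isSmall_geom₁.tendsto_lambert tendsto_qexp_half tendsto_qexp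
  have h2 := isSmall_geom₁.tendsto_lambert (x := fun τ => -qexp τ)
    (by simpa using tendsto_qexp.neg) tendsto_qexp
  have h3 := (((h1.sub h2).const_mul 2).const_add (1 / 4)).const_mul (twoPiI ^ 2)
  convert h3 using 2
  · rw [E₁, E₂]; ring
  · ring

theorem tendsto_E₂_sub_E₃_div :
    Tendsto (fun τ => (E₂ τ - E₃ τ) / qexp (τ / 2)) vertInfty (𝓝 (4 * twoPiI ^ 2)) := by
  have h1 := isSmall_geom₁.tendsto_lambert_div_self tendsto_geom₁_div_self tendsto_qexp_half
    (fun τ => qexp_ne_zero _) tendsto_qexp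
  have h2 := isSmall_geom₁.tendsto_lambert_div_self tendsto_geom₁_div_self
    (x := fun τ => -qexp (τ / 2)) (by simpa using tendsto_qexp_half.neg)
    (fun τ => neg_ne_zero.2 (qexp_ne_zero _)) tendsto_qexp
  have h3 := ((h1.add h2).const_mul 2).const_mul (twoPiI ^ 2)
  convert h3 using 2
  · rw [E₂, E₃, div_neg]; ring
  · ring

theorem eventually_E₂_sub_E₁_ne_zero : ∀ᶠ τ in vertInfty, E₂ τ - E₁ τ ≠ 0 :=
  tendsto_E₂_sub_E₁.eventually_ne (div_ne_zero (pow_ne_zero _ twoPiI_ne_zero) (by norm_num))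

theorem eventually_e_eq : ∀ᶠ τ in vertInfty,
    e₁ (ofComplex τ) = E₁ τ ∧ e₂ (ofComplex τ) = E₂ τ ∧ e₃ (ofComplex τ) = E₃ τ := by
  filter_upwards [eventually_im_gt_vertInfty 0, eventually_norm_le_half tendsto_qexp,
    eventually_norm_le_half tendsto_qexp_half] with τ h0 h1 h2
  rw [ofComplex_apply_of_im_pos h0]
  exact ⟨e₁_eq h1, e₂_eq h2, e₃_eq h2⟩

theorem tt_eventuallyEq :
    tt ∘ ofComplex =ᶠ[vertInfty] fun τ => (E₃ τ - E₁ τ) / (E₂ τ - E₁ τ) := by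
  filter_upwards [eventually_e_eq] with τ h
  rw [Function.comp, tt, h.1, h.2.1, h.2.2]

theorem eventually_differentiableAt_tt :
    ∀ᶠ τ in vertInfty, DifferentiableAt ℂ (tt ∘ ofComplex) τ := by
  refine eventually_differentiableAt_congr tt_eventuallyEq ?_
  filter_upwards [eventually_differentiableAt_E₁, eventually_differentiableAt_E₂,
    eventually_differentiableAt_E₃, eventually_E₂_sub_E₁_ne_zero] with τ h1 h2 h3 h4
  exact (h3.fun_sub h1).fun_div (h2.fun_sub h1) h4

theorem one_sub_tt_eventuallyEq :
    (fun τ => 1 - tt (ofComplex τ)) =ᶠ[vertInfty] fun τ => (E₂ τ - E₃ τ) / (E₂ τ - E₁ τ) := by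
  filter_upwards [tt_eventuallyEq, eventually_E₂_sub_E₁_ne_zero] with τ h1 h2
  rw [Function.comp] at h1
  rw [h1, one_sub_div h2]
  congr 1
  ring

theorem tendsto_one_sub_tt_div :
    Tendsto (fun τ => (1 - tt (ofComplex τ)) / qexp (τ / 2)) vertInfty (𝓝 16) := by
  have hne := twoPiI_ne_zero
  have h := tendsto_E₂_sub_E₃_div.div tendsto_E₂_sub_E₁
    (div_ne_zero (pow_ne_zero _ hne) (by norm_num))
  rw [show 4 * twoPiI ^ 2 / (twoPiI ^ 2 / 4) = 16 by field_simp; norm_num] at h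
  refine h.congr' ?_
  filter_upwards [one_sub_tt_eventuallyEq] with τ hτ
  rw [hτ, Pi.div_apply, div_right_comm]

/-! ### Leading behaviour of Hitchin's solution. -/

section hitchin

variable {r s : ℂ}

/-- The `q`-expansion of `℘(r + sτ)`. -/
def wpSeries (r s τ : ℂ) : ℂ := twoPiI ^ 2 * (1 / 12 + lambert geom₁ (qexp (r + s * τ)) (qexp τ) +
  lambert geom₁ (qexp (-r + (1 - s) * τ)) (qexp τ) - 2 * lambert geom₁ (qexp τ) (qexp τ))

/-- The `q`-expansion of `℘'(r + sτ)`. -/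
def wpDerivSeries (r s τ : ℂ) : ℂ := twoPiI ^ 3 * (lambert geom₂ (qexp (r + s * τ)) (qexp τ) -
  lambert geom₂ (qexp (-r + (1 - s) * τ)) (qexp τ))

/-- The `q`-expansion of `Z_{r,s}(τ)`. -/
def ZSeries (r s τ : ℂ) : ℂ := twoPiI * (s - 1 / 2 - (lambert geom₀ (qexp (r + s * τ)) (qexp τ) -
  lambert geom₀ (qexp (-r + (1 - s) * τ)) (qexp τ)))

theorem differentiable_qexp_affine (a b : ℂ) : Differentiable ℂ fun τ : ℂ => qexp (b + a * τ) := by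
  unfold qexp
  fun_prop

theorem tendsto_qexp_u (hs₀ : 0 < s.re) :
    Tendsto (fun τ => qexp (r + s * τ)) vertInfty (𝓝 0) :=
  tendsto_qexp_vertInfty r hs₀

theorem tendsto_qexp_v (hs₁ : s.re < 1 / 2) :
    Tendsto (fun τ => qexp (-r + (1 - s) * τ)) vertInfty (𝓝 0) :=
  tendsto_qexp_vertInfty _ (by simp; linarith)

theorem tendsto_qexp_half_div_u (hs₁ : s.re < 1 / 2) :
    Tendsto (fun τ => qexp (τ / 2) / qexp (r + s * τ)) vertInfty (𝓝 0) := by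
  refine (tendsto_qexp_vertInfty (a := 1 / 2 - s) (-r) (by simp; linarith)).congr fun τ => ?_
  rw [← qexp_sub]
  congr 1
  ring

theorem tendsto_qexp_v_div_u (hs₁ : s.re < 1 / 2) :
    Tendsto (fun τ => qexp (-r + (1 - s) * τ) / qexp (r + s * τ)) vertInfty (𝓝 0) := by
  refine (tendsto_qexp_vertInfty (a := 1 - 2 * s) (-r - r) (by simp; linarith)).congr fun τ => ?_
  rw [← qexp_sub]
  congr 1
  ring

theorem eventually_differentiableAt_lambert_u {f : ℂ → ℂ} (hf : IsSmall f) (hs₀ : 0 < s.re) :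
    ∀ᶠ τ in vertInfty, DifferentiableAt ℂ
      (fun σ => lambert f (qexp (r + s * σ)) (qexp σ)) τ :=
  hf.eventually_differentiableAt_lambert (tendsto_qexp_u hs₀) tendsto_qexp
    (differentiable_qexp_affine s r) differentiable_qexp

theorem eventually_differentiableAt_lambert_v {f : ℂ → ℂ} (hf : IsSmall f) (hs₁ : s.re < 1 / 2) :
    ∀ᶠ τ in vertInfty, DifferentiableAt ℂ
      (fun σ => lambert f (qexp (-r + (1 - s) * σ)) (qexp σ)) τ :=
  hf.eventually_differentiableAt_lambert (tendsto_qexp_v hs₁) tendsto_qexp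
    (differentiable_qexp_affine (1 - s) (-r)) differentiable_qexp

/-- Subtracting `E₂` rather than `E₁` removes the constant term, because `λ - 1` has numerator `℘(p)
- e₂`. The remaining series in `q/u` and `q^{1/2}` are `o(u)` because `Re s < 1/2`. -/
theorem tendsto_wpSeries_sub_E₂_div (hs₀ : 0 < s.re) (hs₁ : s.re < 1 / 2) :
    Tendsto (fun τ => (wpSeries r s τ - E₂ τ) / qexp (r + s * τ)) vertInfty
      (𝓝 (twoPiI ^ 2)) := by
  have h1 := isSmall_geom₁.tendsto_lambert_div_self tendsto_geom₁_div_self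
    (tendsto_qexp_u (r := r) hs₀) (fun τ => qexp_ne_zero _) tendsto_qexp
  have h2 := isSmall_geom₁.tendsto_lambert_div (tendsto_qexp_v hs₁) tendsto_qexp
    (tendsto_qexp_v_div_u (r := r) hs₁)
  have h3 := isSmall_geom₁.tendsto_lambert_div tendsto_qexp_half tendsto_qexp
    (tendsto_qexp_half_div_u (r := r) hs₁)
  have h4 := ((h1.add h2).sub (h3.const_mul 2)).const_mul (twoPiI ^ 2)
  convert h4 using 2
  · rw [wpSeries, E₂]; ring
  · ring

theorem tendsto_wpDerivSeries_div (hs₀ : 0 < s.re) (hs₁ : s.re < 1 / 2) :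
    Tendsto (fun τ => wpDerivSeries r s τ / qexp (r + s * τ)) vertInfty (𝓝 (twoPiI ^ 3)) := by
  have h1 := isSmall_geom₂.tendsto_lambert_div_self tendsto_geom₂_div_self
    (tendsto_qexp_u (r := r) hs₀) (fun τ => qexp_ne_zero _) tendsto_qexp
  have h2 := isSmall_geom₂.tendsto_lambert_div (tendsto_qexp_v hs₁) tendsto_qexp
    (tendsto_qexp_v_div_u (r := r) hs₁)
  have h4 := (h1.sub h2).const_mul (twoPiI ^ 3)
  convert h4 using 2
  · rw [wpDerivSeries]; ring
  · ring

theorem tendsto_ZSeries (hs₀ : 0 < s.re) (hs₁ : s.re < 1 / 2) :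
    Tendsto (fun τ => ZSeries r s τ) vertInfty (𝓝 (twoPiI * (s - 1 / 2))) := by
  have h1 := isSmall_geom₀.tendsto_lambert (tendsto_qexp_u (r := r) hs₀) tendsto_qexp
  have h2 := isSmall_geom₀.tendsto_lambert (tendsto_qexp_v (r := r) hs₁) tendsto_qexp
  have h4 := ((h1.sub h2).const_sub (s - 1 / 2)).const_mul twoPiI
  rwa [sub_zero, sub_zero] at h4

theorem sub_half_ne_zero (hs₁ : s.re < 1 / 2) : s - 1 / 2 ≠ 0 := by
  intro h
  have := congrArg Complex.re h
  norm_num at this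
  linarith

theorem eventually_ZSeries_ne_zero (hs₀ : 0 < s.re) (hs₁ : s.re < 1 / 2) :
    ∀ᶠ τ in vertInfty, ZSeries r s τ ≠ 0 :=
  (tendsto_ZSeries hs₀ hs₁).eventually_ne (mul_ne_zero twoPiI_ne_zero (sub_half_ne_zero hs₁))

theorem lam₀_eventuallyEq (hs₀ : 0 < s.re) (hs₁ : s.re < 1 / 2) :
    lam₀ r s ∘ ofComplex =ᶠ[vertInfty] fun τ =>
      (wpSeries r s τ + wpDerivSeries r s τ / (2 * ZSeries r s τ) - E₁ τ) / (E₂ τ - E₁ τ) := by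
  have hu := tendsto_qexp_u (r := r) hs₀
  have hv := tendsto_qexp_v (r := r) hs₁
  filter_upwards [eventually_im_gt_vertInfty 0, eventually_e_eq, eventually_norm_le_half hu,
    eventually_norm_le_half hv, eventually_norm_le_half tendsto_qexp,
    eventually_norm_le_half tendsto_qexp_half] with τ h0 he h1 h2 h3 h4
  have ev : qexp (τ + -(r + s * τ)) = qexp (-r + (1 - s) * τ) := by
    congr 1; ring
  have hm : ‖qexp (τ + -(r + s * τ))‖ ≤ 1 / 2 := by rwa [ev]
  have ep : qexp (τ + (r + s * τ)) = qexp (r + s * τ) * qexp τ := by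
    rw [qexp_add, mul_comm]
  have hp : ‖qexp (τ + (r + s * τ))‖ ≤ 1 / 2 := by
    rw [ep, norm_mul]
    nlinarith [norm_nonneg (qexp τ), norm_nonneg (qexp (r + s * τ))]
  have hz : 0 < (r + s * τ).im := im_pos_of_norm_qexp_lt (h1.trans_lt (by norm_num))
  rw [ofComplex_apply_of_im_pos h0] at he
  rw [Function.comp, ofComplex_apply_of_im_pos h0, lam₀, he.1, he.2.1]
  have f1 := wp_eq_of_im_pos (τ := ⟨τ, h0⟩) h3 hp hm hz
  have f2 := wpDeriv_eq (τ := ⟨τ, h0⟩) h3 hp hm hz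
  have f3 := Z_eq (τ := ⟨τ, h0⟩) h4 hp hm hz
  change wp ⟨τ, h0⟩ (r + s * τ) = _ at f1
  change wpDeriv ⟨τ, h0⟩ (r + s * τ) = _ at f2
  change (wp ⟨τ, h0⟩ (r + s * τ) + wpDeriv ⟨τ, h0⟩ (r + s * τ) / _ - _) / _ = _
  -- The row `m = 0` is the missing first term of the Lambert series starting at `uq`, turning it
  -- into the one starting at `u`.
  rw [f1, f2, f3, wpSeries, wpDerivSeries, ZSeries, isSmall_geom₀.lambert_eq h1 h3,
    isSmall_geom₁.lambert_eq h1 h3, isSmall_geom₂.lambert_eq h1 h3]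
  simp only [ev, ep, twoPiI]
  congr 4
  · ring
  · ring
  · ring

theorem eventually_differentiableAt_lam₀ (hs₀ : 0 < s.re) (hs₁ : s.re < 1 / 2) :
    ∀ᶠ τ in vertInfty, DifferentiableAt ℂ (lam₀ r s ∘ ofComplex) τ := by
  refine eventually_differentiableAt_congr (lam₀_eventuallyEq hs₀ hs₁) ?_
  have hd := differentiable_qexp
  filter_upwards [eventually_differentiableAt_E₁, eventually_differentiableAt_E₂,
    eventually_E₂_sub_E₁_ne_zero, eventually_ZSeries_ne_zero (r := r) hs₀ hs₁,
    eventually_differentiableAt_lambert_u (r := r) isSmall_geom₀ hs₀,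
    eventually_differentiableAt_lambert_u (r := r) isSmall_geom₁ hs₀,
    eventually_differentiableAt_lambert_u (r := r) isSmall_geom₂ hs₀,
    eventually_differentiableAt_lambert_v (r := r) isSmall_geom₀ hs₁,
    eventually_differentiableAt_lambert_v (r := r) isSmall_geom₁ hs₁,
    eventually_differentiableAt_lambert_v (r := r) isSmall_geom₂ hs₁,
    isSmall_geom₁.eventually_differentiableAt_lambert tendsto_qexp tendsto_qexp hd hd]
    with τ d1 d2 n1 n2 u0 u1 u2 v0 v1 v2 w1
  have g1 : DifferentiableAt ℂ (wpSeries r s) τ := by unfold wpSeries; fun_prop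
  have g2 : DifferentiableAt ℂ (wpDerivSeries r s) τ := by unfold wpDerivSeries; fun_prop
  have g3 : DifferentiableAt ℂ (ZSeries r s) τ := by unfold ZSeries; fun_prop
  exact ((g1.fun_add (g2.fun_div (g3.const_mul 2) (mul_ne_zero two_ne_zero n2))).fun_sub d1).fun_div
    (d2.fun_sub d1) n1

theorem tendsto_lam₀_sub_one_div (hs₀ : 0 < s.re) (hs₁ : s.re < 1 / 2) :
    Tendsto (fun τ => (lam₀ r s (ofComplex τ) - 1) / qexp (r + s * τ)) vertInfty
      (𝓝 (8 * s / (2 * s - 1))) := by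
  have hne := twoPiI_ne_zero
  have hs2 := sub_half_ne_zero hs₁
  have hs3 : 2 * s - 1 ≠ 0 := by
    rw [show 2 * s - 1 = 2 * (s - 1 / 2) by ring]
    exact mul_ne_zero two_ne_zero hs2
  have h := ((tendsto_wpSeries_sub_E₂_div (r := r) hs₀ hs₁).add
    ((tendsto_wpDerivSeries_div (r := r) hs₀ hs₁).div
      ((tendsto_ZSeries (r := r) hs₀ hs₁).const_mul 2)
      (mul_ne_zero two_ne_zero (mul_ne_zero hne hs2)))).div tendsto_E₂_sub_E₁
    (div_ne_zero (pow_ne_zero _ hne) (by norm_num))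
  have e : (twoPiI ^ 2 + twoPiI ^ 3 / (2 * (twoPiI * (s - 1 / 2)))) / (twoPiI ^ 2 / 4) =
      8 * s / (2 * s - 1) := by
    rw [show s - 1 / 2 = (2 * s - 1) / 2 by ring]
    field_simp
    ring
  rw [e] at h
  refine h.congr' ?_
  filter_upwards [lam₀_eventuallyEq (r := r) hs₀ hs₁, eventually_E₂_sub_E₁_ne_zero] with τ h1 h2
  rw [Function.comp] at h1
  rw [h1, div_sub_one h2, Pi.div_apply]
  simp only [Pi.div_apply]
  rw [div_right_comm (wpDerivSeries r s τ), ← add_div, div_right_comm]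
  congr 2
  ring

end hitchin

/-! ### Derivatives and the momentum. -/

/-- If `h → c` along `vertInfty` is holomorphic and `f = e^{2πi(b + aτ)} h`, then
`f' / e^{2πi(b + aτ)} → 2πi a c`. -/
theorem tendsto_deriv_div_qexp {f : ℂ → ℂ} {a b c : ℂ}
    (hd : ∀ᶠ τ in vertInfty, DifferentiableAt ℂ f τ)
    (hf : Tendsto (fun τ => f τ / qexp (b + a * τ)) vertInfty (𝓝 c)) :
    Tendsto (fun τ => deriv f τ / qexp (b + a * τ)) vertInfty (𝓝 (twoPiI * a * c)) := by
  have hd' : ∀ᶠ τ in vertInfty, DifferentiableAt ℂ (fun τ => f τ / qexp (b + a * τ)) τ := by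
    filter_upwards [hd] with τ h
    exact h.fun_div (hasDerivAt_qexp a b τ).differentiableAt (qexp_ne_zero _)
  have h1 := (tendsto_deriv_vertInfty hf hd').add (hf.const_mul (twoPiI * a))
  rw [zero_add] at h1
  refine h1.congr' ?_
  filter_upwards [hd, hd'] with τ h2 h3
  have h4 : HasDerivAt (fun τ => f τ / qexp (b + a * τ) * qexp (b + a * τ)) _ τ :=
    h3.hasDerivAt.fun_mul (hasDerivAt_qexp a b τ)
  have h5 : (fun τ => f τ / qexp (b + a * τ) * qexp (b + a * τ)) = f := by
    ext σ
    exact div_mul_cancel₀ _ (qexp_ne_zero _)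
  rw [h5] at h4
  have := qexp_ne_zero (b + a * τ)
  rw [h4.deriv]
  field_simp

theorem tendsto_deriv_tt_div :
    Tendsto (fun τ => deriv (tt ∘ ofComplex) τ / qexp (τ / 2)) vertInfty (𝓝 (-8 * twoPiI)) := by
  have hh : ∀ τ : ℂ, qexp (0 + 1 / 2 * τ) = qexp (τ / 2) := fun τ => by
    congr 1; ring
  have h := tendsto_deriv_div_qexp (f := fun τ => 1 - (tt ∘ ofComplex) τ) (a := 1 / 2) (b := 0)
    (c := 16) ?_ ?_
  · simp only [hh, deriv_const_sub] at h
    convert h.neg using 2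
    · ring
    · ring
  · filter_upwards [eventually_differentiableAt_tt] with τ h
    exact h.const_sub 1
  · simp only [hh]
    exact tendsto_one_sub_tt_div

section hitchin

variable {r s : ℂ}

theorem tendsto_deriv_lam₀_div (hs₀ : 0 < s.re) (hs₁ : s.re < 1 / 2) :
    Tendsto (fun τ => deriv (lam₀ r s ∘ ofComplex) τ / qexp (r + s * τ)) vertInfty
      (𝓝 (twoPiI * s * (8 * s / (2 * s - 1)))) := by
  have h := tendsto_deriv_div_qexp (f := fun τ => (lam₀ r s ∘ ofComplex) τ - 1) (a := s) (b := r)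
    (c := 8 * s / (2 * s - 1)) ?_ (tendsto_lam₀_sub_one_div hs₀ hs₁)
  · simpa only [deriv_sub_const] using h
  · filter_upwards [eventually_differentiableAt_lam₀ (r := r) hs₀ hs₁] with τ h
    exact h.sub_const 1

/-- The exponent is `2s` because `u` is of order `q^s` and `1 - t` of order `q^{1/2}`. -/
theorem tendsto_ddt_lam₀ (hs₀ : 0 < s.re) (hs₁ : s.re < 1 / 2) :
    Tendsto (fun τ => (tt (ofComplex τ) - 1) * (deriv (lam₀ r s ∘ ofComplex) τ /
      deriv (tt ∘ ofComplex) τ) / qexp (r + s * τ)) vertInfty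
      (𝓝 (2 * s * (8 * s / (2 * s - 1)))) := by
  have hne := twoPiI_ne_zero
  have h := (tendsto_one_sub_tt_div.neg.mul (tendsto_deriv_lam₀_div (r := r) hs₀ hs₁)).div
    tendsto_deriv_tt_div (mul_ne_zero (by norm_num) hne)
  have e : -16 * (twoPiI * s * (8 * s / (2 * s - 1))) / (-8 * twoPiI) =
      2 * s * (8 * s / (2 * s - 1)) := by
    field_simp
    ring
  rw [e] at h
  refine h.congr fun τ => ?_
  have h1 := qexp_ne_zero (τ / 2)
  simp only [Pi.div_apply]
  rw [← div_mul_eq_mul_div, ← neg_div, neg_sub]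
  generalize deriv (tt ∘ ofComplex) τ = D
  generalize deriv (lam₀ r s ∘ ofComplex) τ = N
  generalize qexp (r + s * τ) = u
  rw [div_div_div_cancel_right₀ h1]
  ring

theorem two_mul_sub_one_ne_zero (hs₁ : s.re < 1 / 2) : 2 * s - 1 ≠ 0 := by
  rw [show 2 * s - 1 = 2 * (s - 1 / 2) by ring]
  exact mul_ne_zero two_ne_zero (sub_half_ne_zero hs₁)

theorem ne_zero_of_re_pos (hs₀ : 0 < s.re) : s ≠ 0 := by
  rintro rfl
  simp at hs₀

theorem tendsto_tt : Tendsto (fun τ => tt (ofComplex τ)) vertInfty (𝓝 1) := by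
  have h := (tendsto_one_sub_tt_div.mul tendsto_qexp_half).const_sub 1
  rw [mul_zero, sub_zero] at h
  refine h.congr fun τ => ?_
  rw [div_mul_cancel₀ _ (qexp_ne_zero _)]
  ring

theorem tendsto_one_sub_tt_div_u (hs₁ : s.re < 1 / 2) :
    Tendsto (fun τ => (1 - tt (ofComplex τ)) / qexp (r + s * τ)) vertInfty (𝓝 0) := by
  have h := tendsto_one_sub_tt_div.mul (tendsto_qexp_half_div_u (r := r) hs₁)
  rw [mul_zero] at h
  refine h.congr fun τ => ?_
  rw [div_mul_div_cancel₀ (qexp_ne_zero _)]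

end hitchin

/-- Limits of `λ`, `t` and `t (t - 1) dλ/dt` determine that of the momentum. -/
theorem tendsto_momentum {α : Type*} {l : Filter α} {u t lam lam' : α → ℂ} {a s : ℂ}
    (hu : Tendsto u l (𝓝 0)) (hu0 : ∀ x, u x ≠ 0) (ha : a ≠ 0)
    (ht : Tendsto (fun x => (1 - t x) / u x) l (𝓝 0))
    (hl : Tendsto (fun x => (lam x - 1) / u x) l (𝓝 a))
    (hl' : Tendsto (fun x => (t x - 1) * lam' x / u x) l (𝓝 (2 * s * a))) :
    Tendsto (fun x => momentum (1 / 2) (1 / 2) (1 / 2) (t x) (lam x) (lam' x) * u x) l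
      (𝓝 (s / a)) := by
  have t1 : Tendsto t l (𝓝 1) := by
    have h := (ht.mul hu).const_sub 1
    rw [mul_zero, sub_zero] at h
    refine h.congr fun x => ?_
    rw [div_mul_cancel₀ _ (hu0 x)]
    ring
  have l1 : Tendsto lam l (𝓝 1) := by
    have h := (hl.mul hu).const_add 1
    rw [mul_zero, add_zero] at h
    refine h.congr fun x => ?_
    rw [div_mul_cancel₀ _ (hu0 x)]
    ring
  have hlt : Tendsto (fun x => (lam x - t x) / u x) l (𝓝 a) := by
    have h := hl.add ht
    rw [add_zero] at h
    refine h.congr fun x => ?_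
    rw [← add_div]
    congr 1
    ring
  -- The `θ`-terms of the numerator are half of `(λ-1)(λ-t) + λ(λ-t) - λ(λ-1) = (λ-1)(λ-t) +
  -- λ(1-t)`, which is `o(u)`. The numerator is thus `~ 2s a u` and the denominator `~ 2a² u²`.
  have hN := (t1.mul hl').add ((((hl.mul hlt).mul hu).add (l1.mul ht)).const_mul (1 / 2))
  have hD := ((l1.mul hl).mul hlt).const_mul 2
  have h := hN.div hD (by simpa using ha)
  rw [show (1 * (2 * s * a) + 1 / 2 * (a * a * 0 + 1 * 0)) / (2 * (1 * a * a)) = s / a by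
    field_simp; ring] at h
  refine h.congr fun x => ?_
  have hx := hu0 x
  rw [Pi.div_apply, momentum, div_mul_eq_mul_div,
    ← mul_div_mul_right _ (2 * (lam x * ((lam x - 1) / u x) * ((lam x - t x) / u x)))
      (pow_ne_zero 2 hx)]
  field_simp
  ring

/-! ### The branch of the power of `1 - t`. -/

/-- The imaginary part of a holomorphic function `g → 0` that is real for `Re τ = 0, 2` is
dominated by the distances to these lines. -/
theorem eventually_abs_im_le {g : ℂ → ℂ} {c : ℂ} (hg : Tendsto g vertInfty (𝓝 c))
    (hd : ∀ᶠ τ in vertInfty, DifferentiableAt ℂ g τ)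
    (h0 : ∀ᶠ τ in vertInfty, (τ.re = 0 ∨ τ.re = 2) → (g τ).im = 0) :
    ∀ᶠ τ in vertInfty, 0 ≤ τ.re → τ.re ≤ 2 →
      |(g τ).im| ≤ τ.re ∧ |(g τ).im| ≤ 2 - τ.re := by
  have hd1 : ∀ᶠ τ in vertInfty, ‖deriv g τ‖ ≤ 1 := by
    filter_upwards [(Metric.tendsto_nhds.1 (tendsto_deriv_vertInfty hg hd)) 1 one_pos] with τ h
    rw [dist_zero_right] at h
    exact h.le
  obtain ⟨M, hM⟩ := eventually_vertInfty.1 ((hd.and hd1).and h0) 2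
  have hconv : Convex ℝ (Complex.reCLM ⁻¹' Set.Icc 0 2 ∩ Complex.imCLM ⁻¹' Set.Ici M) :=
    ((convex_Icc 0 2).is_linear_preimage Complex.reCLM.isLinear).inter
      ((convex_Ici M).is_linear_preimage Complex.imCLM.isLinear)
  have hmem : ∀ σ ∈ (Complex.reCLM ⁻¹' Set.Icc 0 2 ∩ Complex.imCLM ⁻¹' Set.Ici M),
      (DifferentiableAt ℂ g σ ∧ ‖deriv g σ‖ ≤ 1) ∧
        ((σ.re = 0 ∨ σ.re = 2) → (g σ).im = 0) := by
    rintro σ ⟨⟨h1, h2⟩, h3⟩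
    exact hM σ (abs_le.2 ⟨by linarith [show 0 ≤ σ.re from h1], h2⟩) h3
  have key : ∀ x y : ℂ, x ∈ (Complex.reCLM ⁻¹' Set.Icc 0 2 ∩ Complex.imCLM ⁻¹' Set.Ici M) →
      y ∈ (Complex.reCLM ⁻¹' Set.Icc 0 2 ∩ Complex.imCLM ⁻¹' Set.Ici M) →
      ‖g y - g x‖ ≤ 1 * ‖y - x‖ := fun x y hx hy =>
    hconv.norm_image_sub_le_of_norm_deriv_le (fun σ hσ => (hmem σ hσ).1.1)
      (fun σ hσ => (hmem σ hσ).1.2) hx hy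
  rw [eventually_vertInfty]
  refine fun A => ⟨M, fun τ _ hi h1 h2 => ?_⟩
  -- The mean value inequality, with `‖g'‖ ≤ 1`, compares `τ` with the point at the same height on
  -- the line `Re = x₀`, where `g` is real.
  have aux : ∀ x₀ : ℝ, (x₀ = 0 ∨ x₀ = 2) → |(g τ).im| ≤ |τ.re - x₀| := by
    intro x₀ hx₀
    have hmem' : (⟨x₀, τ.im⟩ : ℂ) ∈
        (Complex.reCLM ⁻¹' Set.Icc 0 2 ∩ Complex.imCLM ⁻¹' Set.Ici M) := by
      refine ⟨?_, hi⟩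
      rcases hx₀ with rfl | rfl <;> simp
    have e1 := key ⟨x₀, τ.im⟩ τ hmem' ⟨⟨h1, h2⟩, hi⟩
    have e2 := (hmem _ hmem').2 hx₀
    have e3 := (Complex.abs_im_le_norm (g τ - g ⟨x₀, τ.im⟩)).trans e1
    have e4 : τ - (⟨x₀, τ.im⟩ : ℂ) = ((τ.re - x₀ : ℝ) : ℂ) := by
      apply Complex.ext <;> simp
    rw [Complex.sub_im, e2, sub_zero, one_mul, e4, Complex.norm_real, Real.norm_eq_abs] at e3
    exact e3
  have a0 := aux 0 (Or.inl rfl)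
  have a2 := aux 2 (Or.inr rfl)
  rw [sub_zero, abs_of_nonneg h1] at a0
  rw [abs_sub_comm, abs_of_nonneg (a := 2 - τ.re) (by linarith)] at a2
  exact ⟨a0, a2⟩

theorem conj_twoPiI_sq : (starRingEnd ℂ) (twoPiI ^ 2) = twoPiI ^ 2 := by
  simp [twoPiI, map_ofNat]

theorem conj_qexp_half {τ : ℂ} (h : τ.re = 0 ∨ τ.re = 2) :
    (starRingEnd ℂ) (qexp (τ / 2)) = qexp (τ / 2) := by
  have key : ∀ y : ℝ, (starRingEnd ℂ) (qexp (y * Complex.I)) = qexp (y * Complex.I) := by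
    intro y
    have : qexp (y * Complex.I) = (Real.exp (-(2 * Real.pi * y)) : ℝ) := by
      rw [qexp, Complex.ofReal_exp]
      congr 1
      push_cast
      linear_combination 2 * (Real.pi : ℂ) * y * Complex.I_sq
    rw [this, Complex.conj_ofReal]
  rcases h with h | h
  · have : τ / 2 = ((τ.im / 2 : ℝ) : ℂ) * Complex.I := by
      apply Complex.ext <;> simp [h]
    rw [this, key]
  · have : τ / 2 = 1 + ((τ.im / 2 : ℝ) : ℂ) * Complex.I := by
      apply Complex.ext <;> simp [h]
    have h1 : qexp 1 = 1 := by
      rw [qexp, mul_one, Complex.exp_two_pi_mul_I]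
    rw [this, qexp_add, h1, one_mul, key]

/-- `log ((1 - t) / (16 e^{πiτ}))`, a function that tends to `0`. -/
def logRatio (τ : ℂ) : ℂ := Complex.log ((1 - tt (ofComplex τ)) / 16 / qexp (τ / 2))

theorem tendsto_ratio :
    Tendsto (fun τ => (1 - tt (ofComplex τ)) / 16 / qexp (τ / 2)) vertInfty (𝓝 1) := by
  have h := tendsto_one_sub_tt_div.div_const 16
  rw [div_self (by norm_num)] at h
  refine h.congr fun τ => ?_
  rw [div_right_comm]

theorem tendsto_logRatio : Tendsto logRatio vertInfty (𝓝 0) := by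
  have h := tendsto_ratio.clog (Complex.one_mem_slitPlane)
  rwa [Complex.log_one] at h

/-- On `Re τ = 0` and `Re τ = 2` the number `q^{1/2}` is real, and the expansions in it have real
coefficients. Mere convergence to `0` would not suffice: near these lines the argument of `1 - t`
could leave `[0, 2π)`. -/
theorem eventually_abs_im_logRatio_le : ∀ᶠ τ in vertInfty, 0 ≤ τ.re → τ.re ≤ 2 →
    |(logRatio τ).im| ≤ τ.re ∧ |(logRatio τ).im| ≤ 2 - τ.re := by
  have hslit : ∀ᶠ τ in vertInfty,
      (1 - tt (ofComplex τ)) / 16 / qexp (τ / 2) ∈ Complex.slitPlane :=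
    tendsto_ratio.eventually (Complex.isOpen_slitPlane.mem_nhds Complex.one_mem_slitPlane)
  have hre : ∀ᶠ τ in vertInfty, 0 < ((1 - tt (ofComplex τ)) / 16 / qexp (τ / 2)).re := by
    have := (Complex.continuous_re.tendsto 1).comp tendsto_ratio
    exact this.eventually (lt_mem_nhds (by simp))
  refine eventually_abs_im_le tendsto_logRatio ?_ ?_
  · filter_upwards [hslit, eventually_differentiableAt_tt] with τ h1 h2
    have h3 : DifferentiableAt ℂ (fun τ => (1 - tt (ofComplex τ)) / 16 / qexp (τ / 2)) τ :=
      ((h2.const_sub 1).div_const 16).fun_div (differentiable_qexp_half τ) (qexp_ne_zero _)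
    exact h3.clog h1
  · filter_upwards [hre, one_sub_tt_eventuallyEq] with τ h1 h2 h3
    have hc : (starRingEnd ℂ) ((1 - tt (ofComplex τ)) / 16 / qexp (τ / 2)) =
        (1 - tt (ofComplex τ)) / 16 / qexp (τ / 2) := by
      have c1 := conj_qexp_half h3
      have c2 : (starRingEnd ℂ) (qexp τ) = qexp τ := by
        rw [← qexp_half_mul_self, map_mul, c1]
      rw [h2, E₁, E₂, E₃]
      simp only [map_div₀, map_sub, map_mul, map_add, conj_twoPiI_sq, conj_lambert_geom₁, map_neg,
        c1, c2, map_one, map_ofNat]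
    rw [logRatio, Complex.log_im, Complex.arg_eq_zero_iff]
    exact ⟨h1.le, Complex.conj_eq_iff_im.1 hc⟩

theorem cpow₂_exp {z : ℂ} (w : ℂ) (h0 : 0 ≤ z.im) (h1 : z.im < 2 * Real.pi) :
    cpow₂ (Complex.exp z) w = Complex.exp (w * z) := by
  have h : toIcoMod Real.two_pi_pos 0 (Complex.arg (Complex.exp z)) = z.im := by
    rw [Complex.arg_exp, toIocMod, toIcoMod_sub_zsmul, toIcoMod_eq_self]
    exact ⟨h0, by rwa [zero_add]⟩
  rw [cpow₂, h, Complex.norm_exp, Real.log_exp, Complex.re_add_im]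

theorem eventually_one_sub_tt_eq : ∀ᶠ τ in vertInfty,
    (1 - tt (ofComplex τ)) / 16 = Complex.exp (Real.pi * Complex.I * τ + logRatio τ) := by
  filter_upwards [tendsto_ratio.eventually_ne one_ne_zero] with τ h
  rw [Complex.exp_add, logRatio, Complex.exp_log h, qexp,
    show 2 * Real.pi * Complex.I * (τ / 2) = Real.pi * Complex.I * τ by ring,
    mul_div_cancel₀ _ (Complex.exp_ne_zero _)]

theorem eventually_cpow₂_eq (s : ℂ) : ∀ᶠ τ in vertInfty, 0 ≤ τ.re → τ.re < 2 →
    cpow₂ ((1 - tt (ofComplex τ)) / 16) (2 * s) =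
      qexp (s * τ) * Complex.exp (2 * s * logRatio τ) := by
  filter_upwards [eventually_one_sub_tt_eq, eventually_abs_im_logRatio_le] with τ h1 h2 h3 h4
  obtain ⟨h5, h6⟩ := h2 h3 h4.le
  have hpi := Real.pi_gt_three
  have him : (Real.pi * Complex.I * τ + logRatio τ).im = Real.pi * τ.re + (logRatio τ).im := by
    simp
  rw [abs_le] at h5 h6
  -- With `x = Re τ` the argument lies between `πx - x ≥ 0` and `πx + (2 - x) < 2π`.
  rw [h1, cpow₂_exp _ (by rw [him]; nlinarith) (by rw [him]; nlinarith), qexp, ← Complex.exp_add]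
  congr 1
  ring

/-! ### Okamoto transformations acting on leading terms. -/

theorem tendsto_const_div {α : Type*} {l : Filter α} {f : α → ℂ} {b : ℂ} (c : ℂ)
    (hf : Tendsto f l (𝓝 b)) (hb : b ≠ 0) : Tendsto (fun x => c / f x) l (𝓝 (c / b)) :=
  tendsto_const_nhds.div hf hb

/-- A family of points of phase space with constant parameters `θ` and, relative to a small
quantity `u`, the leading behaviour `1 - t = o(u)`, `λ = 1 + a u + o(u)`, `μ ~ c / (a u)`. -/
structure IsAsymp {α : Type*} (l : Filter α) (u : α → ℂ) (P : α → Pt)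
    (θ₀ θ₁ θ₂ θ₃ θ₄ a c : ℂ) : Prop where
  ne_zero : a ≠ 0
  eq₀ : ∀ x, (P x).θ₀ = θ₀
  eq₁ : ∀ x, (P x).θ₁ = θ₁
  eq₂ : ∀ x, (P x).θ₂ = θ₂
  eq₃ : ∀ x, (P x).θ₃ = θ₃
  eq₄ : ∀ x, (P x).θ₄ = θ₄
  t : Tendsto (fun x => (1 - (P x).t) / u x) l (𝓝 0)
  lam : Tendsto (fun x => ((P x).lam - 1) / u x) l (𝓝 a)
  mu : Tendsto (fun x => (P x).mu * u x) l (𝓝 (c / a))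

namespace IsAsymp

variable {α : Type*} {l : Filter α} {u : α → ℂ} {P : α → Pt} {θ₀ θ₁ θ₂ θ₃ θ₄ a c : ℂ}

/-- The added `θ₀/μ ~ (θ₀ a / c) u` is of the same order as `λ - 1`. As `μ` is kept, so is the ratio
`c/a`. -/
theorem okamoto_zero (h : IsAsymp l u P θ₀ θ₁ θ₂ θ₃ θ₄ a c)
    (hc : c ≠ 0) (hc' : c + θ₀ ≠ 0) :
    IsAsymp l u (fun x => κ₀ (P x)) (-θ₀) (θ₁ + θ₀) (θ₂ + θ₀) (θ₃ + θ₀) (θ₄ + θ₀)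
      (a * ((c + θ₀) / c)) (c + θ₀) where
  ne_zero := mul_ne_zero h.ne_zero (div_ne_zero hc' hc)
  eq₀ x := by simp [κ₀, h.eq₀]
  eq₁ x := by simp [κ₀, h.eq₀, h.eq₁]
  eq₂ x := by simp [κ₀, h.eq₀, h.eq₂]
  eq₃ x := by simp [κ₀, h.eq₀, h.eq₃]
  eq₄ x := by simp [κ₀, h.eq₀, h.eq₄]
  t := h.t
  lam := by
    have ha := h.ne_zero
    have h1 := h.lam.add (tendsto_const_div θ₀ h.mu (div_ne_zero hc ha))
    rw [show a + θ₀ / (c / a) = a * ((c + θ₀) / c) by field_simp] at h1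
    refine h1.congr fun x => ?_
    simp only [κ₀, h.eq₀]
    rw [← div_div, ← add_div]
    congr 1
    ring
  mu := by
    have ha := h.ne_zero
    rw [show (c + θ₀) / (a * ((c + θ₀) / c)) = c / a by field_simp]
    exact h.mu

theorem okamoto_four (h : IsAsymp l u P θ₀ θ₁ θ₂ θ₃ θ₄ a c) :
    IsAsymp l u (fun x => κ₄ (P x)) (θ₀ + θ₄) θ₁ θ₂ θ₃ (-θ₄) a c where
  ne_zero := h.ne_zero
  eq₀ x := by simp [κ₄, h.eq₀, h.eq₄]
  eq₁ := h.eq₁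
  eq₂ := h.eq₂
  eq₃ := h.eq₃
  eq₄ x := by simp [κ₄, h.eq₄]
  t := h.t
  lam := h.lam
  mu := h.mu

theorem tendsto_lam (h : IsAsymp l u P θ₀ θ₁ θ₂ θ₃ θ₄ a c) (hu : Tendsto u l (𝓝 0))
    (hu0 : ∀ x, u x ≠ 0) : Tendsto (fun x => (P x).lam) l (𝓝 1) := by
  have h1 := (h.lam.mul hu).const_add 1
  rw [mul_zero, add_zero] at h1
  refine h1.congr fun x => ?_
  rw [div_mul_cancel₀ _ (hu0 x)]
  ring

/-- `θ₁/λ` stays bounded because `λ → 1`, so it is negligible against `1/u`. -/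
theorem okamoto_one (h : IsAsymp l u P θ₀ θ₁ θ₂ θ₃ θ₄ a c) (hu : Tendsto u l (𝓝 0))
    (hu0 : ∀ x, u x ≠ 0) :
    IsAsymp l u (fun x => κ₁ (P x)) (θ₀ + θ₁) (-θ₁) θ₂ θ₃ θ₄ a c where
  ne_zero := h.ne_zero
  eq₀ x := by simp [κ₁, h.eq₀, h.eq₁]
  eq₁ x := by simp [κ₁, h.eq₁]
  eq₂ := h.eq₂
  eq₃ := h.eq₃
  eq₄ := h.eq₄
  t := h.t
  lam := h.lam
  mu := by
    have h1 := h.mu.sub ((tendsto_const_div θ₁ (h.tendsto_lam hu hu0) one_ne_zero).mul hu)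
    rw [mul_zero, sub_zero] at h1
    refine h1.congr fun x => ?_
    simp only [κ₁, h.eq₁]
    ring

theorem okamoto_two (h : IsAsymp l u P θ₀ θ₁ θ₂ θ₃ θ₄ a c) :
    IsAsymp l u (fun x => κ₂ (P x)) (θ₀ + θ₂) θ₁ (-θ₂) θ₃ θ₄ a (c - θ₂) where
  ne_zero := h.ne_zero
  eq₀ x := by simp [κ₂, h.eq₀, h.eq₂]
  eq₁ := h.eq₁
  eq₂ x := by simp [κ₂, h.eq₂]
  eq₃ := h.eq₃
  eq₄ := h.eq₄
  t := h.t
  lam := h.lam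
  mu := by
    have h1 := h.mu.sub (tendsto_const_div θ₂ h.lam h.ne_zero)
    rw [← sub_div] at h1
    refine h1.congr fun x => ?_
    simp only [κ₂, h.eq₂]
    rw [div_div_eq_mul_div]
    ring

/-- Since `1 - t = o(u)`, `λ - t` has the same leading term as `λ - 1`, so the effect on `c` is that
of `κ₂`. -/
theorem okamoto_three (h : IsAsymp l u P θ₀ θ₁ θ₂ θ₃ θ₄ a c) :
    IsAsymp l u (fun x => κ₃ (P x)) (θ₀ + θ₃) θ₁ θ₂ (-θ₃) θ₄ a (c - θ₃) where
  ne_zero := h.ne_zero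
  eq₀ x := by simp [κ₃, h.eq₀, h.eq₃]
  eq₁ := h.eq₁
  eq₂ := h.eq₂
  eq₃ x := by simp [κ₃, h.eq₃]
  eq₄ := h.eq₄
  t := h.t
  lam := h.lam
  mu := by
    have h0 := h.lam.add h.t
    rw [add_zero] at h0
    have h1 := h.mu.sub (tendsto_const_div θ₃ h0 h.ne_zero)
    rw [← sub_div] at h1
    refine h1.congr fun x => ?_
    simp only [κ₃, h.eq₃]
    rw [← add_div, div_div_eq_mul_div,
      show (P x).lam - 1 + (1 - (P x).t) = (P x).lam - (P x).t by ring]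
    ring

theorem okamoto_three_two_one (h : IsAsymp l u P θ₀ θ₁ θ₂ θ₃ θ₄ a c) (hu : Tendsto u l (𝓝 0))
    (hu0 : ∀ x, u x ≠ 0) :
    IsAsymp l u (fun x => κ₃ (κ₂ (κ₁ (P x)))) (θ₀ + θ₁ + θ₂ + θ₃) (-θ₁) (-θ₂) (-θ₃) θ₄ a
      (c - θ₂ - θ₃) :=
  (h.okamoto_one hu hu0).okamoto_two.okamoto_three

theorem congr {θ₀' θ₁' θ₂' θ₃' θ₄' a' c' : ℂ} (h : IsAsymp l u P θ₀ θ₁ θ₂ θ₃ θ₄ a c)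
    (h0 : θ₀ = θ₀') (h1 : θ₁ = θ₁') (h2 : θ₂ = θ₂') (h3 : θ₃ = θ₃') (h4 : θ₄ = θ₄')
    (ha : a = a') (hc : c = c') : IsAsymp l u P θ₀' θ₁' θ₂' θ₃' θ₄' a' c' := by
  subst h0 h1 h2 h3 h4 ha hc
  exact h

end IsAsymp

/-- A complex number with real part in `(0, 1/2)` is not a half-integer. -/
theorem ne_half_int {s : ℂ} (hs₀ : 0 < s.re) (hs₁ : s.re < 1 / 2) (k : ℤ) : s ≠ k / 2 := by
  intro h
  have h1 := congrArg Complex.re h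
  rw [show (k : ℂ) / 2 = ((k / 2 : ℝ) : ℂ) by push_cast; rfl, Complex.ofReal_re] at h1
  have h2 : (0 : ℝ) < k := by linarith
  have h3 : (k : ℝ) < 1 := by linarith
  have h4 : (0 : ℤ) < k := by exact_mod_cast h2
  have h5 : k < (1 : ℤ) := by exact_mod_cast h3
  lia

theorem add_half_int_ne_zero {s : ℂ} (hs₀ : 0 < s.re) (hs₁ : s.re < 1 / 2) (k : ℤ) :
    s + k / 2 ≠ 0 := by
  intro h
  refine ne_half_int hs₀ hs₁ (-k) ?_
  push_cast
  linear_combination h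

section iterate

variable {α : Type*} {l : Filter α} {u : α → ℂ} {P : α → Pt} {a s : ℂ}

/-- The exponent `c` runs through `s`, `s + n/2`, `s - (n+2)/2`, `s + (n+1)/2`, `s - (n+3)/2`, `s`.
Each of the three `κ₀` multiplies `a` by new `c` over old `c`, and the two factors `s` cancel. -/
theorem IsAsymp.okamoto_five (n : ℕ) (hs₀ : 0 < s.re) (hs₁ : s.re < 1 / 2)
    (h : IsAsymp l u P (-((n + 1) / 2)) (1 / 2) (1 / 2) (1 / 2) (n + 1 / 2) a s)
    (hu : Tendsto u l (𝓝 0)) (hu0 : ∀ x, u x ≠ 0) :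
    IsAsymp l u (fun x => κ₅ (P x)) (-(((n + 2 : ℕ) + 1) / 2)) (1 / 2) (1 / 2) (1 / 2)
      ((n + 2 : ℕ) + 1 / 2)
      (a * (((s + n / 2) * (s + (n + 1) / 2)) / ((s - (n + 2) / 2) * (s - (n + 3) / 2)))) s := by
  have n0 : s ≠ 0 := by simpa using add_half_int_ne_zero hs₀ hs₁ 0
  have n1 : s + n / 2 ≠ 0 := by simpa using add_half_int_ne_zero hs₀ hs₁ n
  have n2 : s + (n + 1) / 2 ≠ 0 := by simpa using add_half_int_ne_zero hs₀ hs₁ (n + 1)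
  have n3 : s - (n + 2) / 2 ≠ 0 := by
    convert add_half_int_ne_zero hs₀ hs₁ (-(n + 2)) using 1
    push_cast
    ring
  have n4 : s - (n + 3) / 2 ≠ 0 := by
    convert add_half_int_ne_zero hs₀ hs₁ (-(n + 3)) using 1
    push_cast
    ring
  have h4 := h.okamoto_four
  have h0 := (h4.okamoto_zero n0 (by convert n1 using 1; ring)).congr
    (θ₀' := -(n / 2)) (θ₁' := (n + 1) / 2) (θ₂' := (n + 1) / 2) (θ₃' := (n + 1) / 2)
    (θ₄' := -((n + 1) / 2)) (a' := a * ((s + n / 2) / s)) (c' := s + n / 2)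
    (by ring) (by ring) (by ring) (by ring) (by ring) (by ring) (by ring)
  have h5 := (h0.okamoto_three_two_one hu hu0).congr
    (θ₀' := n + 3 / 2) (θ₁' := -((n + 1) / 2)) (θ₂' := -((n + 1) / 2)) (θ₃' := -((n + 1) / 2))
    (θ₄' := -((n + 1) / 2)) (a' := a * ((s + n / 2) / s)) (c' := s - (n + 2) / 2)
    (by ring) (by ring) (by ring) (by ring) (by ring) (by ring) (by ring)
  have h6 := (h5.okamoto_zero n3 (by convert n2 using 1; ring)).congr
    (θ₀' := -(n + 3 / 2)) (θ₁' := (n + 2) / 2) (θ₂' := (n + 2) / 2) (θ₃' := (n + 2) / 2)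
    (θ₄' := (n + 2) / 2)
    (a' := a * ((s + n / 2) / s) * ((s + (n + 1) / 2) / (s - (n + 2) / 2)))
    (c' := s + (n + 1) / 2)
    (by ring) (by ring) (by ring) (by ring) (by ring) (by ring) (by ring)
  have h7 := (h6.okamoto_three_two_one hu hu0).congr
    (θ₀' := (n + 3) / 2) (θ₁' := -((n + 2) / 2)) (θ₂' := -((n + 2) / 2)) (θ₃' := -((n + 2) / 2))
    (θ₄' := (n + 2) / 2)
    (a' := a * ((s + n / 2) / s) * ((s + (n + 1) / 2) / (s - (n + 2) / 2)))
    (c' := s - (n + 3) / 2)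
    (by ring) (by ring) (by ring) (by ring) (by ring) (by ring) (by ring)
  refine (h7.okamoto_zero n4 (by convert n0 using 1; ring)).congr ?_ ?_ ?_ ?_ ?_ ?_ ?_
  · push_cast; ring
  · ring
  · ring
  · ring
  · push_cast; ring
  · rw [show s - (n + 3) / 2 + (n + 3) / 2 = s by ring]
    field_simp
  · ring

theorem isAsymp_κ₀ₙ (hs₀ : 0 < s.re) (hs₁ : s.re < 1 / 2)
    (h : IsAsymp l u P (-(1 / 2)) (1 / 2) (1 / 2) (1 / 2) (1 / 2) (8 * s / (2 * s - 1)) s)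
    (hu : Tendsto u l (𝓝 0)) (hu0 : ∀ x, u x ≠ 0) (n : ℕ) :
    IsAsymp l u (fun x => κ₀ₙ n (P x)) (-((n + 1) / 2)) (1 / 2) (1 / 2) (1 / 2) (n + 1 / 2)
      (C n s) s := by
  have n0 : s ≠ 0 := by simpa using add_half_int_ne_zero hs₀ hs₁ 0
  have n1 : s - 1 ≠ 0 := by
    have := add_half_int_ne_zero hs₀ hs₁ (-2)
    norm_num at this
    simpa [sub_eq_add_neg] using this
  induction n using Nat.twoStepInduction with
  | zero =>
    have e : (fun x => κ₀ₙ 0 (P x)) = P := by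
      ext1 x; simp [κ₀ₙ]
    rw [e]
    exact h.congr (by simp) rfl rfl rfl (by simp) (by simp [C]) rfl
  | one =>
    have e : (fun x => κ₀ₙ 1 (P x)) = fun x => κ₀ (κ₃ (κ₂ (κ₁ (P x)))) := by
      ext1 x; simp [κ₀ₙ]
    rw [e]
    have h1 := (h.okamoto_three_two_one hu hu0).congr
      (θ₀' := 1) (θ₁' := -(1 / 2)) (θ₂' := -(1 / 2)) (θ₃' := -(1 / 2)) (θ₄' := 1 / 2)
      (a' := 8 * s / (2 * s - 1)) (c' := s - 1)
      (by ring) (by ring) (by ring) (by ring) (by ring) (by ring) (by ring)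
    have n2 := two_mul_sub_one_ne_zero hs₁
    refine (h1.okamoto_zero n1 (by simpa using n0)).congr ?_ ?_ ?_ ?_ ?_ ?_ ?_
    · norm_num
    · norm_num
    · norm_num
    · norm_num
    · norm_num
    · simp only [C, Nat.not_even_one, if_false, Nat.reduceDiv, Finset.range_zero,
        Finset.prod_empty, mul_one, sub_add_cancel]
      field_simp
    · ring
  | more n ih _ =>
    have e : (fun x => κ₀ₙ (n + 2) (P x)) = fun x => κ₅ (κ₀ₙ n (P x)) := by
      ext1 x
      simp only [κ₀ₙ, Nat.even_add, even_two, iff_true, Nat.add_div_right n two_pos,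
        Function.iterate_succ']
      split_ifs <;> rfl
    rw [e]
    refine (ih.okamoto_five n hs₀ hs₁ hu hu0).congr rfl rfl rfl rfl rfl ?_ rfl
    simp only [C, Nat.even_add, even_two, iff_true, Nat.add_div_right n two_pos]
    split_ifs with hn
    · obtain ⟨k, rfl⟩ := hn
      rw [show (k + k) / 2 = k by lia, Finset.prod_range_succ, ← mul_assoc]
      push_cast
      congr 1
      congr 1 <;> ring
    · obtain ⟨k, rfl⟩ := Nat.not_even_iff_odd.1 hn
      rw [show (2 * k + 1) / 2 = k by lia, Finset.prod_range_succ, ← mul_assoc]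
      push_cast
      congr 1
      congr 1 <;> ring

end iterate

/-! ### Back to `F₂` and powers of `1 - t`. -/

section main

variable {r s : ℂ}

theorem isAsymp_hitchinPt (hs₀ : 0 < s.re) (hs₁ : s.re < 1 / 2) :
    IsAsymp F₂atInfty (fun τ : ℍ => qexp (r + s * τ)) (hitchinPt r s)
      (-(1 / 2)) (1 / 2) (1 / 2) (1 / 2) (1 / 2) (8 * s / (2 * s - 1)) s := by
  have ha : 8 * s / (2 * s - 1) ≠ 0 :=
    div_ne_zero (mul_ne_zero (by norm_num) (ne_zero_of_re_pos hs₀)) (two_mul_sub_one_ne_zero hs₁)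
  have hu := (tendsto_qexp_u (r := r) hs₀).comp tendsto_coe_F₂atInfty
  have ht := (tendsto_one_sub_tt_div_u (r := r) hs₁).comp tendsto_coe_F₂atInfty
  have hl := (tendsto_lam₀_sub_one_div (r := r) hs₀ hs₁).comp tendsto_coe_F₂atInfty
  have hl' := (tendsto_ddt_lam₀ (r := r) hs₀ hs₁).comp tendsto_coe_F₂atInfty
  simp only [Function.comp_def, ofComplex_apply] at hu ht hl hl'
  exact
  { ne_zero := ha
    eq₀ := fun _ => rfl
    eq₁ := fun _ => rfl
    eq₂ := fun _ => rfl
    eq₃ := fun _ => rfl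
    eq₄ := fun _ => rfl
    t := ht
    lam := hl
    mu := tendsto_momentum hu (fun _ => qexp_ne_zero _) ha ht hl hl' }

theorem isBigO_qexp_one_sub_tt (hs₀ : 0 < s.re) :
    (fun τ : ℍ => qexp (r + s * τ)) =O[F₂atInfty]
      fun τ : ℍ => ‖1 - tt τ‖ ^ (2 * s.re) := by
  have h := tendsto_one_sub_tt_div.norm.comp tendsto_coe_F₂atInfty
  simp only [Function.comp_def, ofComplex_apply] at h
  have h1 : ∀ᶠ τ : ℍ in F₂atInfty, 1 < ‖(1 - tt τ) / qexp (τ / 2)‖ :=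
    h.eventually (lt_mem_nhds (by norm_num))
  -- The constant bounds the part `Im r + Im s · Re τ` of `Im (r + sτ)`, where `0 ≤ Re τ < 2`.
  refine Asymptotics.IsBigO.of_bound
    (Real.exp (2 * Real.pi * (|r.im| + 2 * |s.im|))) ?_
  filter_upwards [h1, eventually_mem_F₂] with τ h2 h3
  obtain ⟨h4, h5, -⟩ := h3
  rw [norm_div, one_lt_div (norm_pos_iff.2 (qexp_ne_zero _))] at h2
  rw [Real.norm_of_nonneg (by positivity)]
  have h6 : ‖qexp (τ / 2)‖ ^ (2 * s.re) = Real.exp (-(2 * Real.pi * (s.re * τ.im))) := by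
    rw [norm_qexp, ← Real.exp_mul]
    congr 1
    simp
    ring
  have h7 : ‖qexp (τ / 2)‖ ^ (2 * s.re) ≤ ‖1 - tt τ‖ ^ (2 * s.re) := by
    gcongr
  calc ‖qexp (r + s * τ)‖
      ≤ Real.exp (2 * Real.pi * (|r.im| + 2 * |s.im|)) *
        Real.exp (-(2 * Real.pi * (s.re * τ.im))) := by
        rw [norm_qexp, ← Real.exp_add, Real.exp_le_exp]
        have e1 := neg_abs_le r.im
        have e2 : -(|s.im| * 2) ≤ s.im * τ.re := by
          have : |s.im * τ.re| ≤ |s.im| * 2 := by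
            rw [abs_mul, abs_of_nonneg h4]
            gcongr
          exact (neg_le_neg this).trans (neg_abs_le _)
        have e3 : (r + s * τ).im = r.im + (s.re * τ.im + s.im * τ.re) := by
          simp
        rw [e3]
        nlinarith [Real.pi_pos]
    _ ≤ _ := by
        rw [← h6]
        gcongr

end main

end PainleveLame

end

open PainleveLame in
theorem mainTheorem10 (n : ℕ) (r s : ℂ)
    (hrs : ¬ ∃ j k : ℤ, r = (j : ℂ) / 2 ∧ s = (k : ℂ) / 2)
    (hs₀ : 0 < s.re) (hs₁ : s.re < 1 / 2) :
    Filter.Tendsto PainleveLame.tt PainleveLame.F₂atInfty (nhds 1) ∧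
    (fun τ : UpperHalfPlane =>
      PainleveLame.lam n r s τ -
        (1 + PainleveLame.C n s * Complex.exp (2 * Real.pi * Complex.I * r) *
          PainleveLame.cpow₂ ((1 - PainleveLame.tt τ) / 16) (2 * s)))
      =o[PainleveLame.F₂atInfty]
    (fun τ : UpperHalfPlane => ‖1 - PainleveLame.tt τ‖ ^ (2 * s.re)) := by
  have hu := (tendsto_qexp_u (r := r) hs₀).comp tendsto_coe_F₂atInfty
  have hA := isAsymp_κ₀ₙ hs₀ hs₁ (isAsymp_hitchinPt (r := r) hs₀ hs₁) hu
    (fun _ => qexp_ne_zero _) n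
  refine ⟨?_, ?_⟩
  · have := tendsto_tt.comp tendsto_coe_F₂atInfty
    simpa only [Function.comp_def, ofComplex_apply] using this
  refine Asymptotics.IsLittleO.trans_isBigO ?_ (isBigO_qexp_one_sub_tt (r := r) hs₀)
  rw [Asymptotics.isLittleO_iff_tendsto' (Filter.Eventually.of_forall fun τ h =>
    absurd h (qexp_ne_zero _))]
  have hg : Filter.Tendsto (fun τ : ℍ => Complex.exp (2 * s * logRatio τ)) F₂atInfty
      (nhds 1) := by
    have h1 := ((tendsto_logRatio.comp tendsto_coe_F₂atInfty).const_mul (2 * s)).cexp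
    rwa [mul_zero, Complex.exp_zero] at h1
  -- Divided by `u`, the power term is exactly `C n s · e^{2s logRatio}`, so the quotient tends to
  -- `C n s - C n s = 0`.
  have h := hA.lam.sub (hg.const_mul (C n s))
  rw [mul_one, sub_self] at h
  refine h.congr' ?_
  filter_upwards [tendsto_coe_F₂atInfty.eventually (eventually_cpow₂_eq s), eventually_mem_F₂]
    with τ h1 h2
  have h3 := h1 h2.1 h2.2.1
  rw [ofComplex_apply] at h3
  have h4 : qexp (r + s * τ) = Complex.exp (2 * Real.pi * Complex.I * r) * qexp (s * τ) :=
    qexp_add r (s * τ)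
  have h5 := qexp_ne_zero (r + s * τ)
  rw [h3, PainleveLame.lam, eq_div_iff h5, sub_mul, div_mul_cancel₀ _ h5, h4]
  ring
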